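/- A graph (finite, simple, undirected) is \emph{chordal} if every cycle of length at least four has a chord, i.e. an edge joining two vertices that are not consecutive on the cycle. A \emph{homeomorphically irreducible spanning tree} (HIST) of a connected graph $G$ is a spanning tree of $G$ that contains no vertex of degree two. \textbf{Corollary.} There is a polynomial-time algorithm which, given a (connected) chordal graph $G$ of diameter at most $3$, determines whether $G$ has a HIST. That is, there are an algorithm and a polynomial $p$ such that on every connected chordal graph $G$ with $n$ vertices and diameter at most $3$, given by its adjacency matrix, the algorithm halts after at most $p(n)$ steps and answers correctly whether $G$ has a HIST. (Here an algorithm is a program for a unit-cost random access machine with addition and subtraction but without multiplication.) -/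

import Mathlib

/-! ### Graphs -/

/-- A graph is chordal if every cycle of length at least four has a chord, i.e. an edge of the
graph that joins two vertices of the cycle which are not consecutive on it. -/
def IsChordal {V : Type*} (G : SimpleGraph V) : Prop :=
  ∀ ⦃v : V⦄ (c : G.Walk v v), c.IsCycle → 4 ≤ c.length →
    ∃ x ∈ c.support, ∃ y ∈ c.support, G.Adj x y ∧ s(x, y) ∉ c.edges

/-- `T` is a homeomorphically irreducible spanning tree (HIST) of `G`: a spanning tree of `G`
without vertices of degree two. -/
def IsHIST {V : Type*} (G T : SimpleGraph V) : Prop :=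
  T ≤ G ∧ T.IsTree ∧ ∀ v : V, (T.neighborSet v).ncard ≠ 2

/-- `G` has a HIST. -/
def HasHIST {V : Type*} (G : SimpleGraph V) : Prop :=
  ∃ T : SimpleGraph V, IsHIST G T

/-! ### Random access machines

Structured programs for the usual unit-cost random access machine with addition and truncated
subtraction (and no multiplication), over natural numbers. One step at most doubles the largest
value present, so that numbers have at most linearly many bits in the running time, and polynomial
time on this machine agrees with polynomial time on Turing machines. -/

namespace RAM

/-- The state of the machine: the contents of its registers and of its memory cells. -/
structure State where
  reg : ℕ → ℕ
  mem : ℕ → ℕ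

/-- Write `a` into register `x`. -/
def State.setReg (s : State) (x a : ℕ) : State :=
  { s with reg := Function.update s.reg x a }

/-- Write `a` into the memory cell with address `i`. -/
def State.setMem (s : State) (i a : ℕ) : State :=
  { s with mem := Function.update s.mem i a }

/-- Programs; `x`, `y`, `z` are names of registers. -/
inductive Program where
  /-- do nothing -/
  | skip
  /-- `x := a` for a literal `a` -/
  | const (x a : ℕ)
  /-- `x := y + z` -/
  | add (x y z : ℕ)
  /-- `x := y - z`, which is `0` if `y < z` -/
  | sub (x y z : ℕ)
  /-- `x := mem[y]` -/
  | load (x y : ℕ)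
  /-- `mem[x] := y` -/
  | store (x y : ℕ)
  /-- first `p`, then `q` -/
  | seq (p q : Program)
  /-- if `x < y` then `p` else `q` -/
  | ite (x y : ℕ) (p q : Program)
  /-- while `x < y` do `p` -/
  | loop (x y : ℕ) (p : Program)

/-- `Run p s t s'`: started in state `s`, the program `p` halts in state `s'` after exactly `t`
steps. Each instruction and each evaluation of a test is one step. -/
inductive Run : Program → State → ℕ → State → Prop
  | skip (s : State) : Run .skip s 1 s
  | const (s : State) (x a : ℕ) : Run (.const x a) s 1 (s.setReg x a)
  | add (s : State) (x y z : ℕ) : Run (.add x y z) s 1 (s.setReg x (s.reg y + s.reg z))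
  | sub (s : State) (x y z : ℕ) : Run (.sub x y z) s 1 (s.setReg x (s.reg y - s.reg z))
  | load (s : State) (x y : ℕ) : Run (.load x y) s 1 (s.setReg x (s.mem (s.reg y)))
  | store (s : State) (x y : ℕ) : Run (.store x y) s 1 (s.setMem (s.reg x) (s.reg y))
  | seq {p q : Program} {s s₁ s₂ : State} {t₁ t₂ : ℕ} :
      Run p s t₁ s₁ → Run q s₁ t₂ s₂ → Run (.seq p q) s (t₁ + t₂) s₂
  | ite_true {x y : ℕ} {p q : Program} {s s₁ : State} {t : ℕ} :
      s.reg x < s.reg y → Run p s t s₁ → Run (.ite x y p q) s (1 + t) s₁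
  | ite_false {x y : ℕ} {p q : Program} {s s₁ : State} {t : ℕ} :
      ¬ s.reg x < s.reg y → Run q s t s₁ → Run (.ite x y p q) s (1 + t) s₁
  | loop_true {x y : ℕ} {p : Program} {s s₁ s₂ : State} {t₁ t₂ : ℕ} :
      s.reg x < s.reg y → Run p s t₁ s₁ → Run (.loop x y p) s₁ t₂ s₂ →
        Run (.loop x y p) s (1 + t₁ + t₂) s₂
  | loop_false {x y : ℕ} {p : Program} {s : State} :
      ¬ s.reg x < s.reg y → Run (.loop x y p) s 1 s

/-- The machine is deterministic: running time and final state are determined by the program and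
the initial state. -/
theorem Run.unique {p : Program} {s s₁ s₂ : State} {t₁ t₂ : ℕ}
    (h₁ : Run p s t₁ s₁) (h₂ : Run p s t₂ s₂) : t₁ = t₂ ∧ s₁ = s₂ := by
  induction h₁ generalizing t₂ s₂ with
  | seq _ _ ih₁ ih₂ =>
    cases h₂ with
    | seq a b =>
      obtain ⟨rfl, rfl⟩ := ih₁ a
      obtain ⟨rfl, rfl⟩ := ih₂ b
      exact ⟨rfl, rfl⟩
  | ite_true h _ ih =>
    cases h₂ with
    | ite_true _ a => obtain ⟨rfl, rfl⟩ := ih a; exact ⟨rfl, rfl⟩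
    | ite_false h' _ => exact absurd h h'
  | ite_false h _ ih =>
    cases h₂ with
    | ite_true h' _ => exact absurd h' h
    | ite_false _ a => obtain ⟨rfl, rfl⟩ := ih a; exact ⟨rfl, rfl⟩
  | loop_true h _ _ ih₁ ih₂ =>
    cases h₂ with
    | loop_true _ a b =>
      obtain ⟨rfl, rfl⟩ := ih₁ a
      obtain ⟨rfl, rfl⟩ := ih₂ b
      exact ⟨rfl, rfl⟩
    | loop_false h' => exact absurd h h'
  | loop_false h =>
    cases h₂ with
    | loop_true h' _ _ => exact absurd h' h
    | loop_false _ => exact ⟨rfl, rfl⟩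
  | _ => cases h₂; exact ⟨rfl, rfl⟩

open Classical in
/-- The initial state for an input graph on the vertices `0, …, n - 1`: register `0` holds `n`,
the memory holds the adjacency matrix of the graph row by row (the entry in row `i` and column `j`
is in cell `i * n + j`), and everything else is `0`. -/
noncomputable def input {n : ℕ} (G : SimpleGraph (Fin n)) : State where
  reg x := if x = 0 then n else 0
  mem a := if ∃ i j : Fin n, a = i * n + j ∧ G.Adj i j then 1 else 0

/-- There is a program which, given any graph with `n` vertices from the class `C`, halts within a
number of steps that is polynomial in `n`, with answer `1` in register `0` if the graph has the
property `Q`, and with answer `0` in register `0` otherwise. -/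
def DecidableInPolyTime (C Q : ∀ {n : ℕ}, SimpleGraph (Fin n) → Prop) : Prop :=
  ∃ (P : Program) (b : Polynomial ℕ), ∀ (n : ℕ) (G : SimpleGraph (Fin n)), C G →
    ∃ (t : ℕ) (s : State), Run P (input G) t s ∧ t ≤ b.eval n ∧
      (Q G → s.reg 0 = 1) ∧ (¬ Q G → s.reg 0 = 0)

end RAM

/-!
Two facts carry the proof. First, a property of graphs that a first-order sentence defines is
decidable in polynomial time on the random access machine: every quantifier becomes a loop over the
vertices (`RAM.decidableInPolyTime_of_sentence`). Second, within the chordal graphs of diameter at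
most three, having a HIST is such a property (`IsChordal.hasHIST_iff`): a graph of this class has a
HIST unless it contains one of three explicit structures (`IsObstructed`), which are described by at
most five exceptional vertices and by the vertices that have a pendant neighbour.

An obstruction excludes a HIST `T` by counting. A vertex with a pendant neighbour has degree at
least three in `T`. By the definition of an obstruction its neighbours, apart from the pendant one,
lie in a set `Q` of vertices of the same kind or are exceptional. The exceptional vertices can be
added to `Q` until a single one, `v`, is left, so that every vertex of `Q` has two neighbours in
`Q ∪ {v}`. This is impossible in a tree: consider a vertex of `Q` at the largest distance from `v`
(`SimpleGraph.IsTree.not_two_neighbors`).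

For the converse, a chordal graph of diameter at most three has a dominating clique
(`IsChordal.exists_dominating_clique`). Choose one with the fewest vertices. If it is a single
vertex, there is a spanning star. Otherwise every `w ∈ K` has a private neighbour `y w`, a vertex
outside `K` whose only neighbour in `K` is `w` (`exists_isPrivateFrame`); by chordality these are
pairwise non-adjacent. If two further vertices can be attached to different vertices of `K`, then a
Hamiltonian path of `K` between these is the spine of a caterpillar in which every vertex of the
spine carries a leaf and the ends carry two, so that no degree is two. If not, then either all
further vertices are attached to one vertex of `K` only, which is an obstruction, or there is just
one further vertex `r`. In this case the number of private neighbours that see `r` decides: with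
none or one there is an obstruction, and with two or more there is a caterpillar with `r` as an end
of its spine or, if `r` has only two neighbours in `K`, an obstruction or a vertex adjacent to all
others (`IsPrivateFrame.hasHIST_or_isObstructed`).
-/

/-! ### Dominating cliques in chordal graphs -/

section Domination

variable {V : Type*} {G : SimpleGraph V}

/-- If `u` sees only the first vertex of a walk `p` and a neighbour `s` of `u` sees the last vertex
of `p`, then in a chordal graph `s` sees the first vertex of `p`, too: on a shortest
counterexample, `s`, `u` and `p` form a chordless cycle. -/
theorem IsChordal.adj_start_of_walk (hG : IsChordal G) {u s : V} (hsu : G.Adj s u) {a b : V}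
    (p : G.Walk a b) (hu : u ∉ p.support) (hs : s ∉ p.support) (hua : G.Adj u a) (hbs : G.Adj b s)
    (honly : ∀ x ∈ p.support, G.Adj u x → x = a) : G.Adj s a := by
  classical
  induction hn : p.length using Nat.strong_induction_on generalizing b p with
  | _ n ih =>
  subst hn
  -- shorter walks on a subset of the vertices are covered by the induction hypothesis
  have key : ∀ {b' : V} (q : G.Walk a b'), q.length < p.length → q.support ⊆ p.support →
      G.Adj b' s → G.Adj s a := fun q hl hq hb =>
    ih _ hl q (fun h => hu (hq h)) (fun h => hs (hq h)) hb (fun x hx => honly x (hq hx)) rfl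
  by_cases hp : p.IsPath
  swap
  · exact key p.bypass (by
      rcases lt_or_eq_of_le p.length_bypass_le_length with h | h
      · exact h
      · exact absurd (p.bypass_eq_self_of_length_le_length_bypass h.ge ▸ p.bypass_isPath) hp)
      p.support_bypass_subset_support hbs
  by_cases hab : a = b
  · subst hab; exact hbs.symm
  have hpos : 0 < p.length := by
    rcases Nat.eq_zero_or_pos p.length with h | h
    · exact absurd (SimpleGraph.Walk.eq_of_length_eq_zero h) hab
    · exact h
  have hbp := p.end_mem_support
  have hap := p.start_mem_support
  have hcyc : (SimpleGraph.Walk.cons hbs (.cons hsu (.cons hua p))).IsCycle := by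
    rw [SimpleGraph.Walk.cons_isCycle_iff]
    refine ⟨?_, ?_⟩
    · simp [SimpleGraph.Walk.cons_isPath_iff, hp, hu, hs, hsu.ne]
    · simp only [SimpleGraph.Walk.edges_cons, List.mem_cons, not_or]
      refine ⟨?_, ?_, fun h => hs (p.snd_mem_support_of_mem_edges h)⟩
      · rw [Sym2.eq_iff]
        rintro (⟨rfl, -⟩ | ⟨rfl, -⟩)
        · exact hs hbp
        · exact hu hbp
      · rw [Sym2.eq_iff]
        rintro (⟨rfl, -⟩ | ⟨-, rfl⟩)
        · exact hu hbp
        · exact hsu.ne rfl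
  obtain ⟨x, hx, y, hy, hxy, hne⟩ := hG _ hcyc (by simp; omega)
  simp only [SimpleGraph.Walk.support_cons, List.mem_cons, SimpleGraph.Walk.edges_cons,
    not_or] at hx hy hne
  obtain ⟨h1, h2, h3, h4⟩ := hne
  -- a chord at `s`
  have chord_s : ∀ y ∈ p.support, G.Adj s y → y ≠ b → G.Adj s a := fun y hy hsy hyb =>
    key (p.takeUntil y hy) (SimpleGraph.Walk.length_takeUntil_lt_length hy hyb)
      (p.support_takeUntil_subset_support hy) hsy.symm
  -- a chord of the path `p`
  have chord_p : ∀ i j, i < j → j ≤ p.length → G.Adj (p.getVert i) (p.getVert j) →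
      s(p.getVert i, p.getVert j) ∉ p.edges → G.Adj s a := by
    intro i j hij hj hadj hnot
    have hij' : i + 1 < j := by
      rcases Nat.lt_or_ge (i + 1) j with h | h
      · exact h
      · have : j = i + 1 := by omega
        subst this
        exact absurd (p.mk_mem_edges_iff_exists.2 ⟨i, by omega, rfl⟩) hnot
    refine key ((p.take i).append (.cons hadj (p.drop j))) ?_ ?_ hbs
    · simp; omega
    · intro w hw
      rw [SimpleGraph.Walk.mem_support_append_iff] at hw
      rcases hw with hw | hw
      · exact (p.isSubwalk_take i).support_subset hw
      · simp only [SimpleGraph.Walk.support_cons, List.mem_cons] at hw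
        rcases hw with rfl | hw
        · exact p.getVert_mem_support i
        · exact (p.isSubwalk_drop j).support_subset hw
  have hx' : x = s ∨ x = u ∨ x ∈ p.support := by
    rcases hx with rfl | rfl | rfl | h <;> simp_all
  have hy' : y = s ∨ y = u ∨ y ∈ p.support := by
    rcases hy with rfl | rfl | rfl | h <;> simp_all
  rcases hx' with rfl | rfl | hx' <;> rcases hy' with rfl | rfl | hy'
  · exact absurd rfl hxy.ne
  · exact absurd rfl h2
  · exact chord_s y hy' hxy (by rintro rfl; exact h1 Sym2.eq_swap)
  · exact absurd Sym2.eq_swap h2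
  · exact absurd rfl hxy.ne
  · exact absurd (by rw [honly y hy' hxy]) h3
  · exact chord_s x hx' hxy.symm (by rintro rfl; exact h1 rfl)
  · exact absurd (by rw [honly x hx' hxy.symm]; exact Sym2.eq_swap) h3
  · obtain ⟨i, rfl, hi⟩ := SimpleGraph.Walk.mem_support_iff_exists_getVert.1 hx'
    obtain ⟨j, rfl, hj⟩ := SimpleGraph.Walk.mem_support_iff_exists_getVert.1 hy'
    rcases lt_trichotomy i j with h | h | h
    · exact chord_p i j h hj hxy h4
    · subst h; exact absurd rfl hxy.ne
    · exact chord_p j i h hi hxy.symm (by rwa [Sym2.eq_swap])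

/-- In a chordal graph, every cycle of length four has a diagonal. -/
theorem IsChordal.adj_of_square (hG : IsChordal G) {a b c d : V} (hab : G.Adj a b)
    (hbc : G.Adj b c) (hcd : G.Adj c d) (hda : G.Adj d a) (hac : a ≠ c) (hbd : b ≠ d) :
    G.Adj a c ∨ G.Adj b d := by
  by_contra! h
  refine h.2 (hG.adj_start_of_walk (s := b) (u := a) hab.symm (.cons hcd.symm .nil) ?_ ?_ hda.symm
    hbc.symm ?_)
  · simp [hac, hda.ne']
  · simp [hbd, hbc.ne]
  · simp only [SimpleGraph.Walk.support_cons, SimpleGraph.Walk.support_nil, List.mem_cons,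
      List.not_mem_nil, or_false]
    rintro x (rfl | rfl) hx
    · rfl
    · exact absurd hx h.1

/-- If every vertex of a clique `K` of a chordal graph has a neighbour in a connected set `C`
outside `K`, then a single vertex of `C` is adjacent to all of `K`. -/
theorem IsChordal.exists_adj_all [Finite V] (hG : IsChordal G) (C : Set V) (hC : C.Nonempty)
    (hconn : ∀ c ∈ C, ∀ d ∈ C, ∃ p : G.Walk c d, ∀ x ∈ p.support, x ∈ C)
    (K : Set V) (hK : G.IsClique K) (hKC : ∀ x ∈ K, x ∉ C)
    (hnb : ∀ u ∈ K, ∃ c ∈ C, G.Adj u c) : ∃ c ∈ C, ∀ u ∈ K, G.Adj u c := by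
  classical
  obtain ⟨c, hc, hmax⟩ := Set.exists_max_image C (fun c => {u | u ∈ K ∧ G.Adj u c}.ncard)
    (Set.toFinite _) hC
  refine ⟨c, hc, ?_⟩
  by_contra! h
  obtain ⟨u, huK, huc⟩ := h
  obtain ⟨d, hd, hud⟩ := hnb u huK
  -- a shortest walk in `C` from a neighbour of `u` to `c`
  have hex : ∃ n, ∃ (a : V) (p : G.Walk a c), G.Adj u a ∧ (∀ x ∈ p.support, x ∈ C) ∧
      p.length = n := by
    obtain ⟨p, hp⟩ := hconn d hd c hc
    exact ⟨_, d, p, hud, hp, rfl⟩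
  obtain ⟨a, p, hua, hp, hlen⟩ := Nat.find_spec hex
  have haC : a ∈ C := hp _ p.start_mem_support
  have honly : ∀ x ∈ p.support, G.Adj u x → x = a := by
    intro x hx hux
    by_contra hxa
    have hlt := SimpleGraph.Walk.length_dropUntil_lt_length hx hxa
    rw [hlen] at hlt
    exact Nat.find_min hex hlt
      ⟨x, p.dropUntil x hx, hux, fun y hy => hp y (p.support_dropUntil_subset_support hx hy), rfl⟩
  have hlt : {s | s ∈ K ∧ G.Adj s c}.ncard < {s | s ∈ K ∧ G.Adj s a}.ncard := by
    refine Set.ncard_lt_ncard ⟨?_, ?_⟩ (Set.toFinite _)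
    · rintro s ⟨hsK, hsc⟩
      have hsu : s ≠ u := by rintro rfl; exact huc hsc
      exact ⟨hsK, hG.adj_start_of_walk (hK hsK huK hsu) p (fun h => hKC _ huK (hp _ h))
        (fun h => hKC _ hsK (hp _ h)) hua hsc.symm honly⟩
    · exact fun hsub => huc (hsub ⟨huK, hua⟩).2
  exact absurd (hmax a haC) (by omega)

/-- `x` is in `K` or has a neighbour in `K`. -/
def IsDominated (G : SimpleGraph V) (K : Set V) (x : V) : Prop :=
  x ∈ K ∨ ∃ k ∈ K, G.Adj k x

/-- The vertices that can be reached from `z` by walks outside `K`. -/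
def componentOutside (G : SimpleGraph V) (K : Set V) (z : V) : Set V :=
  {c | ∃ p : G.Walk z c, ∀ x ∈ p.support, x ∉ K}

theorem mem_componentOutside_of_adj {K : Set V} {z c d : V} (hc : c ∈ componentOutside G K z)
    (hcd : G.Adj c d) (hd : d ∉ K) : d ∈ componentOutside G K z := by
  obtain ⟨p, hp⟩ := hc
  refine ⟨p.concat hcd, fun x hx => ?_⟩
  rw [SimpleGraph.Walk.support_concat, List.mem_append, List.mem_singleton] at hx
  rcases hx with hx | rfl
  · exact hp x hx
  · exact hd

theorem componentOutside_connected {K : Set V} {z c d : V} (hc : c ∈ componentOutside G K z)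
    (hd : d ∈ componentOutside G K z) :
    ∃ p : G.Walk c d, ∀ x ∈ p.support, x ∈ componentOutside G K z := by
  classical
  obtain ⟨p, hp⟩ := hc
  obtain ⟨q, hq⟩ := hd
  refine ⟨p.reverse.append q, fun x hx => ?_⟩
  rw [SimpleGraph.Walk.mem_support_append_iff] at hx
  rcases hx with hx | hx
  · rw [SimpleGraph.Walk.support_reverse, List.mem_reverse] at hx
    exact ⟨p.takeUntil x hx, fun y hy => hp y (p.support_takeUntil_subset_support hx hy)⟩
  · exact ⟨q.takeUntil x hx, fun y hy => hq y (q.support_takeUntil_subset_support hx hy)⟩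

/-- The ball of radius three, spelled out. -/
theorem exists_short_of_ediam_le (hd : G.ediam ≤ 3) (x z : V) :
    x = z ∨ G.Adj z x ∨ (∃ a, G.Adj z a ∧ G.Adj a x) ∨
      ∃ a b, G.Adj z a ∧ G.Adj a b ∧ G.Adj b x := by
  have h : G.edist z x ≤ 3 := SimpleGraph.edist_le_ediam.trans hd
  have hr : G.Reachable z x := SimpleGraph.reachable_of_edist_ne_top
    (ne_top_of_le_ne_top (by decide) h)
  obtain ⟨p, hp⟩ := hr.exists_walk_length_eq_edist
  rw [← hp] at h
  have h3 : p.length ≤ 3 := by exact_mod_cast h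
  match p, h3 with
  | .nil, _ => exact Or.inl rfl
  | .cons h .nil, _ => exact Or.inr (Or.inl h)
  | .cons h (.cons h' .nil), _ => exact Or.inr (Or.inr (Or.inl ⟨_, h, h'⟩))
  | .cons h (.cons h' (.cons h'' .nil)), _ => exact Or.inr (Or.inr (Or.inr ⟨_, _, h, h', h''⟩))
  | .cons _ (.cons _ (.cons _ (.cons _ q))), h3 => simp at h3; omega

/-- In a chordal graph of diameter at most three, a clique can be exchanged for one which dominates
one more vertex `z`: replace it by its part `K₀` that sees the component `C` of `z`, and add a
vertex of `C` adjacent to all of `K₀`. This makes `C` smaller until `z` is dominated. -/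
theorem IsChordal.exists_clique_dominating_insert [Finite V] (hG : IsChordal G) (hd : G.ediam ≤ 3)
    (z : V) (K : Set V) (hK : G.IsClique K) :
    ∃ K' : Set V, G.IsClique K' ∧ IsDominated G K' z ∧
      ∀ x, IsDominated G K x → IsDominated G K' x := by
  induction hn : (componentOutside G K z).ncard using Nat.strong_induction_on generalizing K with
  | _ n ih =>
  subst hn
  by_cases hz : IsDominated G K z
  · exact ⟨K, hK, hz, fun _ h => h⟩
  have hzK : z ∉ K := fun h => hz (Or.inl h)
  have hzN : ∀ a, G.Adj z a → a ∉ K := fun a ha haK => hz (Or.inr ⟨a, haK, ha.symm⟩)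
  set C := componentOutside G K z with hCdef
  have hzC : z ∈ C := ⟨.nil, by simpa using hzK⟩
  have hCK : ∀ x ∈ C, x ∉ K := fun x ⟨p, hp⟩ => hp x p.end_mem_support
  set K₀ : Set V := {k | k ∈ K ∧ ∃ c ∈ C, G.Adj k c} with hK₀
  have hK₀c : G.IsClique K₀ := hK.subset fun k hk => hk.1
  have hout : ∀ c ∈ C, ∀ d, G.Adj c d → d ∉ C → d ∈ K₀ := by
    intro c hc d hcd hdC
    by_contra hdK
    exact hdC (mem_componentOutside_of_adj hc hcd fun h => hdK ⟨h, c, hc, hcd.symm⟩)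
  have hdom : ∀ x, IsDominated G K x → IsDominated G K₀ x := by
    intro x hx
    by_cases hxC : x ∈ C
    · rcases hx with hx | ⟨k, hk, hkx⟩
      · exact absurd hx (hCK x hxC)
      · exact Or.inr ⟨k, ⟨hk, x, hxC, hkx⟩, hkx⟩
    have hzC' : ∀ a, G.Adj z a → a ∈ C := fun a ha => mem_componentOutside_of_adj hzC ha (hzN a ha)
    rcases exists_short_of_ediam_le hd x z with rfl | h | ⟨a, h1, h2⟩ | ⟨a, b, h1, h2, h3⟩
    · exact absurd hzC hxC
    · exact absurd (hzC' x h) hxC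
    · exact Or.inl (hout a (hzC' a h1) x h2 hxC)
    · by_cases hb : b ∈ C
      · exact Or.inl (hout b hb x h3 hxC)
      · exact Or.inr ⟨b, hout a (hzC' a h1) b h2 hb, h3⟩
  obtain ⟨c, hc, hcK₀⟩ := hG.exists_adj_all C ⟨z, hzC⟩
    (fun c hc d hd => componentOutside_connected hc hd) K₀ hK₀c (fun x hx h => hCK x h hx.1)
    (fun u hu => hu.2)
  have hK₁ : G.IsClique (insert c K₀) := by
    rw [SimpleGraph.isClique_insert]
    exact ⟨hK₀c, fun b hb _ => (hcK₀ b hb).symm⟩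
  have hlt : (componentOutside G (insert c K₀) z).ncard < C.ncard := by
    refine Set.ncard_lt_ncard ⟨?_, fun hsub => ?_⟩ (Set.toFinite _)
    · rintro x ⟨p, hp⟩
      by_contra hxC
      obtain ⟨e, he, he1, he2⟩ := p.exists_boundary_dart C hzC hxC
      exact hp _ (p.dart_snd_mem_support_of_mem_darts he)
        (Or.inr (hout _ he1 _ e.adj he2))
    · obtain ⟨p, hp⟩ := hsub hc
      exact hp _ p.end_mem_support (Or.inl rfl)
  obtain ⟨K', h1, h2, h3⟩ := ih _ hlt (insert c K₀) hK₁ rfl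
  refine ⟨K', h1, h2, fun x hx => h3 x ?_⟩
  rcases hdom x hx with h | ⟨k, hk, hkx⟩
  · exact Or.inl (Or.inr h)
  · exact Or.inr ⟨k, Or.inr hk, hkx⟩

/-- A chordal graph of diameter at most three has a dominating clique. -/
theorem IsChordal.exists_dominating_clique [Finite V] (hG : IsChordal G) (hd : G.ediam ≤ 3) :
    ∃ K : Set V, G.IsClique K ∧ ∀ x, IsDominated G K x := by
  suffices h : ∀ S : Set V, S.Finite →
      ∃ K : Set V, G.IsClique K ∧ ∀ x ∈ S, IsDominated G K x by
    obtain ⟨K, hK, h⟩ := h Set.univ (Set.toFinite _)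
    exact ⟨K, hK, fun x => h x trivial⟩
  intro S hS
  induction S, hS using Set.Finite.induction_on with
  | empty => exact ⟨∅, by simp, by simp⟩
  | @insert z S _ _ ih =>
    obtain ⟨K, hK, h⟩ := ih
    obtain ⟨K', hK', hz, h'⟩ := hG.exists_clique_dominating_insert hd z K hK
    refine ⟨K', hK', ?_⟩
    rintro x (rfl | hx)
    · exact hz
    · exact h' x (h x hx)

end Domination

/-! ### First-order properties of graphs are decidable in polynomial time -/

/-- Formulas of the first-order language of graphs. Variables are de Bruijn levels: in a formula
below `d` quantifiers, the variables `0, …, d - 1` are available, and a further quantifier binds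
the variable `d`. -/
inductive Formula where
  | eq (i j : ℕ)
  | adj (i j : ℕ)
  | not (φ : Formula)
  | and (φ ψ : Formula)
  | ex (φ : Formula)

namespace Formula

/-- `φ.Holds G d e`: below `d` quantifiers, the formula `φ` is true in the graph `G` under the
assignment `e`. -/
def Holds {V : Type*} (G : SimpleGraph V) : Formula → ℕ → (ℕ → V) → Prop
  | eq i j, _, e => e i = e j
  | adj i j, _, e => G.Adj (e i) (e j)
  | not φ, d, e => ¬ φ.Holds G d e
  | and φ ψ, d, e => φ.Holds G d e ∧ ψ.Holds G d e
  | ex φ, d, e => ∃ v, φ.Holds G (d + 1) (Function.update e d v)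

/-- All variables of the formula are bound by its quantifiers or are among `0, …, d - 1`. -/
def WellScoped : Formula → ℕ → Prop
  | eq i j, d => i < d ∧ j < d
  | adj i j, d => i < d ∧ j < d
  | not φ, d => φ.WellScoped d
  | and φ ψ, d => φ.WellScoped d ∧ ψ.WellScoped d
  | ex φ, d => φ.WellScoped (d + 1)

end Formula

namespace RAM

@[simp] theorem State.setReg_reg (s : State) (x a y : ℕ) :
    (s.setReg x a).reg y = if y = x then a else s.reg y := by
  simp [State.setReg, Function.update_apply]

@[simp] theorem State.setReg_mem (s : State) (x a : ℕ) : (s.setReg x a).mem = s.mem := rfl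

/-- Entries of the adjacency matrix are stored at different addresses. -/
theorem input_mem {n : ℕ} (G : SimpleGraph (Fin n)) (i j : Fin n) [Decidable (G.Adj i j)] :
    (input G).mem (i * n + j) = if G.Adj i j then 1 else 0 := by
  have key : (∃ i' j' : Fin n, (i : ℕ) * n + j = i' * n + j' ∧ G.Adj i' j') ↔ G.Adj i j := by
    constructor
    · rintro ⟨i', j', h, hadj⟩
      have hn : 0 < n := i.pos
      have hdiv : ∀ a b : Fin n, ((a : ℕ) * n + b) / n = a ∧ ((a : ℕ) * n + b) % n = b := by
        intro a b
        constructor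
        · rw [mul_comm, Nat.mul_add_div hn, Nat.div_eq_of_lt b.2, add_zero]
        · rw [mul_comm, Nat.mul_add_mod, Nat.mod_eq_of_lt b.2]
      have h1 : (i : ℕ) = i' := by rw [← (hdiv i j).1, h, (hdiv i' j').1]
      have h2 : (j : ℕ) = j' := by rw [← (hdiv i j).2, h, (hdiv i' j').2]
      rw [Fin.ext h1, Fin.ext h2]
      exact hadj
    · exact fun h => ⟨i, j, rfl, h⟩
  by_cases h : G.Adj i j <;> simp [input, key, h]

/-- The state `s` represents the assignment `e` of the first `d` variables in the graph `G`.
Register `0` holds the number of vertices, register `5 + j` the variable `j`; register `1` is for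
truth values and `2`, `3`, `4` are scratch registers. -/
structure Represents {n : ℕ} (G : SimpleGraph (Fin n)) (d : ℕ) (e : ℕ → Fin n) (s : State) :
    Prop where
  mem : s.mem = (input G).mem
  size : s.reg 0 = n
  var : ∀ j < d, s.reg (5 + j) = e j

open Classical in
/-- The program `P` evaluates `φ` below `d` quantifiers in a number of steps bounded by `b`: it
leaves the truth value in register `1` and keeps the representation of the assignment. -/
def Evaluates (P : Program) (b : Polynomial ℕ) (φ : Formula) (d : ℕ) : Prop :=
  ∀ (n : ℕ) (G : SimpleGraph (Fin n)) (e : ℕ → Fin n) (s : State), Represents G d e s →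
    ∃ (t : ℕ) (s' : State), Run P s t s' ∧ t ≤ b.eval n ∧ Represents G d e s' ∧
      s'.reg 1 = if φ.Holds G d e then 1 else 0

theorem Represents.setReg {n : ℕ} {G : SimpleGraph (Fin n)} {d : ℕ} {e : ℕ → Fin n} {s : State}
    (h : Represents G d e s) {x a : ℕ} (hx : x ≠ 0) (hx' : x < 5 ∨ 5 + d ≤ x) :
    Represents G d e (s.setReg x a) where
  mem := h.mem
  size := by rw [State.setReg_reg, if_neg hx.symm, h.size]
  var j hj := by rw [State.setReg_reg, if_neg (by omega), h.var j hj]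

theorem evaluates_eq {i j d : ℕ} (hi : i < d) (hj : j < d) :
    Evaluates (.ite (5 + i) (5 + j) (.const 1 0) (.ite (5 + j) (5 + i) (.const 1 0) (.const 1 1)))
      3 (.eq i j) d := by
  classical
  intro n G e s hs
  have h1 := hs.var i hi
  have h2 := hs.var j hj
  rcases lt_trichotomy (s.reg (5 + i)) (s.reg (5 + j)) with h | h | h
  · refine ⟨_, _, .ite_true h (.const _ _ _), by simp, hs.setReg (by omega) (by omega), ?_⟩
    have : e i ≠ e j := fun he => by rw [h1, h2, he] at h; exact lt_irrefl _ h
    simp [Formula.Holds, this]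
  · refine ⟨_, _, .ite_false h.not_lt (.ite_false h.symm.not_lt (.const _ _ _)), by simp,
      hs.setReg (by omega) (by omega), ?_⟩
    have : e i = e j := Fin.ext (by rw [← h1, ← h2, h])
    simp [Formula.Holds, this]
  · refine ⟨_, _, .ite_false h.not_gt (.ite_true h (.const _ _ _)), by simp,
      hs.setReg (by omega) (by omega), ?_⟩
    have : e i ≠ e j := fun he => by rw [h1, h2, he] at h; exact lt_irrefl _ h
    simp [Formula.Holds, this]

/-- The loop that computes the address of an entry of the adjacency matrix: it adds register `0`
to register `3` as many times as register `4` is smaller than register `x`. -/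
theorem run_address_loop (x m : ℕ) (hx : 5 ≤ x) : ∀ s : State, s.reg 2 = 1 →
    s.reg 4 + m = s.reg x →
    ∃ s' : State, Run (.loop 4 x (.seq (.add 3 3 0) (.add 4 4 2))) s (3 * m + 1) s' ∧
      s'.mem = s.mem ∧ s'.reg 3 = s.reg 3 + m * s.reg 0 ∧
      ∀ y, y ≠ 3 → y ≠ 4 → s'.reg y = s.reg y := by
  induction m with
  | zero =>
    intro s _ h
    exact ⟨s, .loop_false (by omega), rfl, by simp, fun _ _ _ => rfl⟩
  | succ m ih =>
    intro s h2 h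
    set s₁ := (s.setReg 3 (s.reg 3 + s.reg 0)) with hs₁
    set s₂ := s₁.setReg 4 (s₁.reg 4 + s₁.reg 2) with hs₂
    have hx3 : x ≠ 3 := by omega
    have hx4 : x ≠ 4 := by omega
    obtain ⟨s', hrun, hmem, h3, hreg⟩ := ih s₂ (by simp [hs₂, hs₁, h2])
      (by simp [hs₂, hs₁, h2, hx3, hx4]; omega)
    refine ⟨s', ?_, hmem, ?_, ?_⟩
    · have := Run.loop_true (by omega : s.reg 4 < s.reg x)
        (Run.seq (Run.add s 3 3 0) (Run.add s₁ 4 4 2)) hrun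
      convert this using 1
      omega
    · rw [h3]; simp [hs₂, hs₁]; ring
    · intro y hy3 hy4
      rw [hreg y hy3 hy4]; simp [hs₂, hs₁, hy3, hy4]

theorem exists_evaluates_adj {i j d : ℕ} (hi : i < d) (hj : j < d) :
    ∃ P b, Evaluates P b (.adj i j) d := by
  classical
  refine ⟨.seq (.const 2 1) (.seq (.const 3 0) (.seq (.const 4 0)
    (.seq (.loop 4 (5 + i) (.seq (.add 3 3 0) (.add 4 4 2)))
      (.seq (.add 3 3 (5 + j)) (.load 1 3))))), 3 * Polynomial.X + 6, ?_⟩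
  intro n G e s hs
  set s₀ := ((s.setReg 2 1).setReg 3 0).setReg 4 0 with hs₀
  have hs₀r : Represents G d e s₀ :=
    ((hs.setReg (by omega) (by omega)).setReg (by omega) (by omega)).setReg (by omega) (by omega)
  obtain ⟨s₁, hrun, hmem, h3, hreg⟩ := run_address_loop (5 + i) (e i) (by omega) s₀ (by simp [hs₀])
    (by rw [hs₀r.var i hi]; simp [hs₀])
  have hs₁r : Represents G d e s₁ :=
    ⟨by rw [hmem, hs₀r.mem], by rw [hreg 0 (by omega) (by omega), hs₀r.size],
      fun k hk => by rw [hreg _ (by omega) (by omega), hs₀r.var k hk]⟩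
  have h3' : s₁.reg 3 + s₁.reg (5 + j) = e i * n + e j := by
    rw [h3, hs₁r.var j hj, hs₀r.size]; simp [hs₀]
  refine ⟨_, _, .seq (.const _ _ _) (.seq (.const _ _ _) (.seq (.const _ _ _) (.seq hrun
    (.seq (.add _ _ _ _) (.load _ _ _))))), ?_, ?_, ?_⟩
  · have := (e i).2
    simp
    omega
  · exact (hs₁r.setReg (by omega) (by omega)).setReg (by omega) (by omega)
  · simp only [State.setReg_reg, if_true, State.setReg_mem]
    rw [h3', hs₁r.mem, input_mem]
    rfl

theorem Evaluates.not {P : Program} {b : Polynomial ℕ} {φ : Formula} {d : ℕ}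
    (h : Evaluates P b φ d) :
    Evaluates (.seq P (.seq (.const 2 1) (.sub 1 2 1))) (b + 2) φ.not d := by
  classical
  intro n G e s hs
  obtain ⟨t, s', hrun, ht, hs', hval⟩ := h n G e s hs
  refine ⟨_, _, .seq hrun (.seq (.const _ _ _) (.sub _ _ _ _)), ?_,
    (hs'.setReg (by omega) (by omega)).setReg (by omega) (by omega), ?_⟩
  · simp; omega
  · by_cases hφ : φ.Holds G d e <;> simp [Formula.Holds, hφ, hval]

theorem Evaluates.and {P Q : Program} {b c : Polynomial ℕ} {φ ψ : Formula} {d : ℕ}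
    (hφ : Evaluates P b φ d) (hψ : Evaluates Q c ψ d) :
    Evaluates (.seq P (.seq (.const 2 0) (.ite 2 1 Q .skip))) (b + c + 3) (φ.and ψ) d := by
  classical
  intro n G e s hs
  obtain ⟨t, s₁, hrun, ht, hs₁, hval⟩ := hφ n G e s hs
  have hs₂ : Represents G d e (s₁.setReg 2 0) := hs₁.setReg (by omega) (by omega)
  by_cases h : φ.Holds G d e
  · obtain ⟨t', s', hrun', ht', hs', hval'⟩ := hψ n G e _ hs₂
    refine ⟨_, s', .seq hrun (.seq (.const _ _ _) (.ite_true (by simp [hval, h]) hrun')), ?_, hs',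
      ?_⟩
    · simp; omega
    · simp [hval', Formula.Holds, h]
  · refine ⟨_, _, .seq hrun (.seq (.const _ _ _) (.ite_false (by simp [hval, h]) (.skip _))), ?_,
      hs₂, ?_⟩
    · simp; omega
    · simp [hval, Formula.Holds, h]

/-- The body of the search loop of a quantifier at depth `d`: run `P` and, if the result is
true, leave the loop by raising the loop variable to the number of vertices. -/
def searchBody (P : Program) (d : ℕ) : Program :=
  .seq P (.seq (.const 2 0)
    (.ite 2 1 (.add (5 + d) 0 2) (.seq (.const 2 1) (.add (5 + d) (5 + d) 2))))

/-- The search loop, started with the loop variable at some value, decides whether a vertex from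
this value on satisfies `φ`. -/
theorem run_search_loop {P : Program} {b : Polynomial ℕ} {φ : Formula} {d : ℕ}
    (hP : Evaluates P b φ (d + 1)) {n : ℕ} (G : SimpleGraph (Fin n)) (e : ℕ → Fin n) (m : ℕ) :
    ∀ s : State, Represents G d e s → s.reg (5 + d) + m = n → s.reg 1 = 0 →
      ∃ (t : ℕ) (s' : State), Run (.loop (5 + d) 0 (searchBody P d)) s t s' ∧
        t ≤ m * (b.eval n + 5) + 1 ∧ Represents G d e s' ∧
        ((∃ v : Fin n, s.reg (5 + d) ≤ v ∧ φ.Holds G (d + 1) (Function.update e d v)) →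
          s'.reg 1 = 1) ∧
        ((¬ ∃ v : Fin n, s.reg (5 + d) ≤ v ∧ φ.Holds G (d + 1) (Function.update e d v)) →
          s'.reg 1 = 0) := by
  classical
  induction m with
  | zero =>
    intro s hs hm h1
    refine ⟨1, s, .loop_false (by rw [hs.size]; omega), by simp, hs, ?_, fun _ => h1⟩
    rintro ⟨v, hv, -⟩
    have := v.2
    omega
  | succ m ih =>
    intro s hs hm h1
    have hlt : s.reg (5 + d) < s.reg 0 := by rw [hs.size]; omega
    set v : Fin n := ⟨s.reg (5 + d), by omega⟩ with hv
    have hsv : Represents G (d + 1) (Function.update e d v) s := by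
      refine ⟨hs.mem, hs.size, fun j hj => ?_⟩
      rcases Nat.lt_succ_iff_lt_or_eq.1 hj with h | rfl
      · rw [Function.update_of_ne h.ne, hs.var j h]
      · simp [hv]
    obtain ⟨t, s₁, hrun, ht, hs₁, hval⟩ := hP n G _ s hsv
    have hs₁d : Represents G d e s₁ := ⟨hs₁.mem, hs₁.size, fun j hj => by
      rw [hs₁.var j (by omega), Function.update_of_ne hj.ne]⟩
    have hs₁v : s₁.reg (5 + d) = s.reg (5 + d) := by
      rw [hs₁.var d (by omega)]; simp [hv]
    by_cases h : φ.Holds G (d + 1) (Function.update e d v)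
    · set s₂ := (s₁.setReg 2 0).setReg (5 + d) ((s₁.setReg 2 0).reg 0 + (s₁.setReg 2 0).reg 2)
        with hs₂
      have hs₂r : Represents G d e s₂ :=
        (hs₁d.setReg (by omega) (by omega)).setReg (by omega) (by omega)
      have hend : ¬ s₂.reg (5 + d) < s₂.reg 0 := by
        rw [hs₂r.size]
        simp [hs₂, hs₁.size]
      refine ⟨_, s₂, .loop_true hlt (.seq hrun (.seq (.const _ _ _) (.ite_true ?_ (.add _ _ _ _))))
        (.loop_false hend), ?_, hs₂r, fun _ => ?_, fun hne => absurd ⟨v, le_refl _, h⟩ hne⟩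
      · simp [hval, h]
      · rw [add_mul]; omega
      · simp [hs₂, hval, h, show (1 : ℕ) ≠ 5 + d by omega]
    · set s₂ := (s₁.setReg 2 0).setReg 2 1 with hs₂
      set s₃ := s₂.setReg (5 + d) (s₂.reg (5 + d) + s₂.reg 2) with hs₃
      have hs₃r : Represents G d e s₃ := ((hs₁d.setReg (by omega) (by omega)).setReg (by omega)
        (by omega)).setReg (by omega) (by omega)
      have hs₃v : s₃.reg (5 + d) = s.reg (5 + d) + 1 := by
        simp [hs₃, hs₂, hs₁v, show 5 + d ≠ 2 by omega]
      obtain ⟨t', s', hrun', ht', hs', hpos, hneg⟩ := ih s₃ hs₃r (by omega)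
        (by simp [hs₃, hs₂, hval, h, show (1 : ℕ) ≠ 5 + d by omega])
      have hiff : (∃ w : Fin n, s.reg (5 + d) ≤ w ∧ φ.Holds G (d + 1) (Function.update e d w)) ↔
          ∃ w : Fin n, s₃.reg (5 + d) ≤ w ∧ φ.Holds G (d + 1) (Function.update e d w) := by
        constructor
        · rintro ⟨w, hw, hφ⟩
          refine ⟨w, ?_, hφ⟩
          rcases Nat.lt_or_ge (s.reg (5 + d)) w with hlt' | hge
          · omega
          · have hwv : w = v := Fin.ext (by simp only [hv]; omega)
            exact absurd (hwv ▸ hφ) h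
        · rintro ⟨w, hw, hφ⟩
          exact ⟨w, by omega, hφ⟩
      refine ⟨_, s', .loop_true hlt (.seq hrun (.seq (.const _ _ _) (.ite_false ?_
        (.seq (.const _ _ _) (.add _ _ _ _))))) hrun', ?_, hs', ?_, ?_⟩
      · simp [hval, h]
      · rw [add_mul]; omega
      · rwa [hiff]
      · rwa [hiff]

theorem Evaluates.ex {P : Program} {b : Polynomial ℕ} {φ : Formula} {d : ℕ}
    (h : Evaluates P b φ (d + 1)) :
    Evaluates (.seq (.const 1 0) (.seq (.const (5 + d) 0) (.loop (5 + d) 0 (searchBody P d))))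
      (Polynomial.X * (b + 5) + 3) φ.ex d := by
  classical
  intro n G e s hs
  set s₀ := (s.setReg 1 0).setReg (5 + d) 0 with hs₀
  have hs₀r : Represents G d e s₀ :=
    (hs.setReg (by omega) (by omega)).setReg (by omega) (by omega)
  have h0 : s₀.reg (5 + d) = 0 := by simp [hs₀]
  obtain ⟨t, s', hrun, ht, hs', hpos, hneg⟩ := run_search_loop h G e n s₀ hs₀r (by omega)
    (by simp [hs₀])
  refine ⟨_, s', .seq (.const _ _ _) (.seq (.const _ _ _) hrun), ?_, hs', ?_⟩
  · simp; omega
  · simp only [h0, Nat.zero_le, true_and] at hpos hneg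
    simp only [Formula.Holds]
    by_cases hex : ∃ v, φ.Holds G (d + 1) (Function.update e d v)
    · exact (hpos hex).trans (if_pos hex).symm
    · exact (hneg hex).trans (if_neg hex).symm

/-- Every formula has an evaluating program, by structural recursion. -/
theorem exists_evaluates (φ : Formula) : ∀ d, φ.WellScoped d → ∃ P b, Evaluates P b φ d := by
  induction φ with
  | eq i j => exact fun d h => ⟨_, _, evaluates_eq h.1 h.2⟩
  | adj i j => exact fun d h => exists_evaluates_adj h.1 h.2
  | not φ ih =>
    intro d h
    obtain ⟨P, b, hP⟩ := ih d h
    exact ⟨_, _, hP.not⟩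
  | and φ ψ ih₁ ih₂ =>
    intro d h
    obtain ⟨P, b, hP⟩ := ih₁ d h.1
    obtain ⟨Q, c, hQ⟩ := ih₂ d h.2
    exact ⟨_, _, hP.and hQ⟩
  | ex φ ih =>
    intro d h
    obtain ⟨P, b, hP⟩ := ih (d + 1) h
    exact ⟨_, _, hP.ex⟩

/-- On a class of nonempty graphs, a property that a first-order sentence defines is decidable in
polynomial time. -/
theorem decidableInPolyTime_of_sentence {C Q : ∀ {n : ℕ}, SimpleGraph (Fin n) → Prop}
    (φ : Formula) (hφ : φ.WellScoped 0)
    (hC : ∀ {n : ℕ} (G : SimpleGraph (Fin n)), C G → 0 < n)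
    (h : ∀ {n : ℕ} (G : SimpleGraph (Fin n)), C G → ∀ e : ℕ → Fin n, φ.Holds G 0 e ↔ Q G) :
    DecidableInPolyTime C Q := by
  classical
  obtain ⟨P, b, hP⟩ := exists_evaluates φ 0 hφ
  refine ⟨.seq P (.seq (.const 2 0) (.add 0 1 2)), b + 2, fun n G hG => ?_⟩
  set e : ℕ → Fin n := fun _ => ⟨0, hC G hG⟩
  obtain ⟨t, s, hrun, ht, -, hval⟩ := hP n G e (input G) ⟨rfl, by simp [input], by simp⟩
  refine ⟨_, _, .seq hrun (.seq (.const _ _ _) (.add _ _ _ _)), ?_, fun hQ => ?_, fun hQ => ?_⟩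
  · simp; omega
  · simp [hval, (h G hG e).2 hQ]
  · simp [hval, mt (h G hG e).1 hQ]

end RAM

/-! ### Obstructions to homeomorphically irreducible spanning trees -/

section Obstructions

variable {V : Type*} {G : SimpleGraph V}

/-- `w` is the only neighbour of `z`. -/
def IsPendant (G : SimpleGraph V) (w z : V) : Prop :=
  G.Adj w z ∧ ∀ x, G.Adj z x → x = w

/-- The vertices outside `X` which have a pendant neighbour outside `X`. -/
def pendantCore (G : SimpleGraph V) (X : Set V) : Set V :=
  {w | w ∉ X ∧ ∃ z ∉ X, IsPendant G w z}

/-- Every vertex of `pendantCore G X` has, apart from its pendant neighbour, all its neighbours in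
`pendantCore G X ∪ X`. -/
def IsTight (G : SimpleGraph V) (X : Set V) : Prop :=
  ∀ w ∈ pendantCore G X, ∀ z z', G.Adj w z → G.Adj w z' → z ∉ pendantCore G X ∪ X →
    z' ∉ pendantCore G X ∪ X → z = z'

/-- The obstruction with one exceptional vertex. The main example is a clique such that each of its
vertices but `v` has a single neighbour outside the clique, and this neighbour is pendant. -/
def OneVertexObstruction (G : SimpleGraph V) : Prop :=
  ∃ v, (pendantCore G {v}).Nonempty ∧ IsTight G {v}

/-- The obstruction with two exceptional vertices `u` and `v`, which share a neighbour `y`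
of degree two. -/
structure IsRoof (G : SimpleGraph V) (u v y : V) : Prop where
  ne : u ≠ v
  adj_iff : ∀ t, G.Adj y t ↔ t = u ∨ t = v
  tight : IsTight G {u, v}
  left : ∀ t, G.Adj u t → t ∈ pendantCore G {u, v} ∨ t = v ∨ t = y
  right : ∀ t, G.Adj v t → t ∈ pendantCore G {u, v} ∨ t = u ∨ t = y

/-- The obstruction with exceptional vertices `a` and `b` and a common neighbour `x`
of them, where the edges `xa` and `xb` carry horns: vertices `y` and `y'` of degree two adjacent to
both ends. -/
structure IsHorned (G : SimpleGraph V) (x a b y y' : V) : Prop where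
  ne : a ≠ b
  y_ne : y ≠ b
  y'_ne : y' ≠ a
  adj_y : ∀ t, G.Adj y t ↔ t = x ∨ t = a
  adj_y' : ∀ t, G.Adj y' t ↔ t = x ∨ t = b
  adj_x : ∀ t, G.Adj x t ↔ t = a ∨ t = b ∨ t = y ∨ t = y'
  nonempty : (pendantCore G {a, b}).Nonempty
  tight : IsTight G {a, b}
  left : ∀ t, G.Adj a t → t ∈ pendantCore G {a, b} ∨ t = b ∨ t = x ∨ t = y
  right : ∀ t, G.Adj b t → t ∈ pendantCore G {a, b} ∨ t = a ∨ t = x ∨ t = y'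

/-- The structures that prevent a chordal graph of diameter at most three from having a HIST. -/
def IsObstructed (G : SimpleGraph V) : Prop :=
  OneVertexObstruction G ∨ (∃ u v y, IsRoof G u v y) ∨ ∃ x a b y y', IsHorned G x a b y y'

theorem IsRoof.symm {u v y : V} (h : IsRoof G u v y) : IsRoof G v u y where
  ne := h.ne.symm
  adj_iff t := (h.adj_iff t).trans or_comm
  tight := Set.pair_comm u v ▸ h.tight
  left t ht := Set.pair_comm u v ▸ h.right t ht
  right t ht := Set.pair_comm u v ▸ h.left t ht

theorem IsHorned.symm {x a b y y' : V} (h : IsHorned G x a b y y') : IsHorned G x b a y' y where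
  ne := h.ne.symm
  y_ne := h.y'_ne
  y'_ne := h.y_ne
  adj_y := h.adj_y'
  adj_y' := h.adj_y
  adj_x t := (h.adj_x t).trans (by tauto)
  nonempty := Set.pair_comm a b ▸ h.nonempty
  tight := Set.pair_comm a b ▸ h.tight
  left t ht := Set.pair_comm a b ▸ h.right t ht
  right t ht := Set.pair_comm a b ▸ h.left t ht

end Obstructions

section Trees

variable {V : Type*} {G T : SimpleGraph V}

/-- In a tree, two different neighbours of `w` cannot both be nearer to `v` than `w` is. -/
theorem SimpleGraph.IsTree.eq_of_dist_add_one (hT : T.IsTree) {v w p q : V} (hp : T.Adj w p)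
    (hq : T.Adj w q) (hdp : T.dist v w = T.dist v p + 1) (hdq : T.dist v w = T.dist v q + 1) :
    p = q := by
  have hpath : ∀ {p}, T.Adj w p → T.dist v w = T.dist v p + 1 →
      ∃ r : T.Walk v w, r.IsPath ∧ r.penultimate = p := by
    intro p hp hdp
    obtain ⟨r, hr⟩ := hT.connected.exists_walk_length_eq_dist v p
    refine ⟨r.concat hp.symm, SimpleGraph.Walk.isPath_of_length_eq_dist _ ?_, by simp⟩
    rw [SimpleGraph.Walk.length_concat, hr, hdp]
  obtain ⟨r, hr, rfl⟩ := hpath hp hdp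
  obtain ⟨r', hr', rfl⟩ := hpath hq hdq
  rw [(hT.existsUnique_path v w).unique hr hr']

/-- A tree has no nonempty set `Q` of vertices and further vertex `v` such that every vertex of `Q`
has two neighbours in `Q ∪ {v}`: a vertex of `Q` farthest from `v` has at most one. -/
theorem SimpleGraph.IsTree.not_two_neighbors [Finite V] (hT : T.IsTree) (Q : Set V)
    (hQ : Q.Nonempty) (v : V) (hv : v ∉ Q)
    (h : ∀ w ∈ Q, ∃ p q, p ≠ q ∧ T.Adj w p ∧ T.Adj w q ∧ (p ∈ Q ∨ p = v) ∧ (q ∈ Q ∨ q = v)) :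
    False := by
  obtain ⟨w, hw, hmax⟩ := Set.exists_max_image Q (T.dist v) (Set.toFinite _) hQ
  obtain ⟨p, q, hpq, hp, hq, hpQ, hqQ⟩ := h w hw
  have key : ∀ p, T.Adj w p → (p ∈ Q ∨ p = v) → T.dist v w = T.dist v p + 1 := by
    intro p hp hpQ
    rcases hT.dist_eq_dist_add_one_of_adj v hp with h | h
    · exact h
    · rcases hpQ with hpQ | rfl
      · have := hmax p hpQ
        omega
      · simp at h
  exact hpq (hT.eq_of_dist_add_one hp hq (key p hp hpQ) (key q hq hqQ))

theorem SimpleGraph.Connected.exists_adj_boundary (hT : T.Connected) (S : Set V) {a b : V}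
    (ha : a ∈ S) (hb : b ∉ S) : ∃ s ∈ S, ∃ t ∉ S, T.Adj s t := by
  obtain ⟨p⟩ := hT.preconnected a b
  obtain ⟨d, -, h1, h2⟩ := p.exists_boundary_dart S ha hb
  exact ⟨_, h1, _, h2, d.adj⟩

theorem exists_third_neighbor {w p q : V} (hw : (T.neighborSet w).ncard ≠ 2) (hpq : p ≠ q)
    (hp : T.Adj w p) (hq : T.Adj w q) : ∃ r, r ≠ p ∧ r ≠ q ∧ T.Adj w r := by
  by_contra! h
  refine hw ?_
  have : T.neighborSet w = {p, q} := by
    ext r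
    simp only [SimpleGraph.mem_neighborSet, Set.mem_insert_iff, Set.mem_singleton_iff]
    constructor
    · intro hr
      by_contra! hne
      exact h r hne.1 hne.2 hr
    · rintro (rfl | rfl) <;> assumption
  rw [this, Set.ncard_pair hpq]

/-- A vertex of a HIST that carries a leaf `z` is not the end of a path, so that it has two
neighbours other than `z`. -/
theorem IsHIST.two_more (hT : IsHIST G T) {w z o : V} (hwz : T.Adj w z)
    (hz : ∀ t, T.Adj z t → t = w) (how : o ≠ w) (hoz : o ≠ z) :
    ∃ p q, p ≠ q ∧ p ≠ z ∧ q ≠ z ∧ T.Adj w p ∧ T.Adj w q := by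
  obtain ⟨s, hs, t, ht, hst⟩ := hT.2.1.connected.exists_adj_boundary {w, z} (a := w) (b := o)
    (by simp) (by simp [how, hoz])
  simp only [Set.mem_insert_iff, Set.mem_singleton_iff, not_or] at hs ht
  rcases hs with rfl | rfl
  · obtain ⟨r, h1, h2, h3⟩ := exists_third_neighbor (hT.2.2 s) (Ne.symm ht.2) hwz hst
    exact ⟨t, r, h2.symm, ht.2, h1, hst, h3⟩
  · exact absurd (hz t hst) ht.1

theorem IsHIST.exists_adj (hT : IsHIST G T) {z o : V} (ho : o ≠ z) : ∃ t, T.Adj z t := by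
  obtain ⟨s, rfl, t, -, hst⟩ := hT.2.1.connected.exists_adj_boundary {z} (a := z) (b := o)
    (by simp) (by simpa using ho)
  exact ⟨t, hst⟩

/-- A vertex of degree two of `G` is a leaf of every HIST of `G`. -/
theorem IsHIST.leaf_of_two (hT : IsHIST G T) {y u v : V} (huv : u ≠ v)
    (hy : ∀ t, G.Adj y t ↔ t = u ∨ t = v) :
    (T.Adj y u ∧ ∀ t, T.Adj y t → t = u) ∨ (T.Adj y v ∧ ∀ t, T.Adj y t → t = v) := by
  obtain ⟨t, ht⟩ := hT.exists_adj (z := y) (o := u) ((hy u).2 (Or.inl rfl)).ne'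
  have hsub : ∀ t, T.Adj y t → t = u ∨ t = v := fun t ht => (hy t).1 (hT.1 ht)
  by_cases hu : T.Adj y u
  · refine Or.inl ⟨hu, fun t ht => ?_⟩
    rcases hsub t ht with h | rfl
    · exact h
    · obtain ⟨r, h1, h2, h3⟩ := exists_third_neighbor (hT.2.2 y) huv hu ht
      rcases hsub r h3 with h | h
      · exact absurd h h1
      · exact absurd h h2
  · have hall : ∀ t, T.Adj y t → t = v := fun t ht => (hsub t ht).resolve_left
      (by rintro rfl; exact hu ht)
    exact Or.inr ⟨hall t ht ▸ ht, hall⟩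

/-- In a HIST, a vertex of a tight core has two neighbours in the core or in `X`: it carries a
leaf, so that its degree is at least three, and all other neighbours are of this kind. -/
theorem IsTight.two_neighbors (hT : IsHIST G T) {X : Set V} (hX : X.Nonempty) (h : IsTight G X)
    {w : V} (hw : w ∈ pendantCore G X) :
    ∃ p q, p ≠ q ∧ T.Adj w p ∧ T.Adj w q ∧ p ∈ pendantCore G X ∪ X ∧ q ∈ pendantCore G X ∪ X := by
  obtain ⟨hwX, z, hzX, hwz, hz⟩ := id hw
  obtain ⟨o, ho⟩ := hX
  have how : o ≠ w := by rintro rfl; exact hwX ho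
  have hoz : o ≠ z := by rintro rfl; exact hzX ho
  have hTz : ∀ t, T.Adj z t → t = w := fun t ht => hz t (hT.1 ht)
  obtain ⟨t, ht⟩ := hT.exists_adj hoz
  obtain ⟨p, q, hpq, hpz, hqz, hp, hq⟩ := hT.two_more (hTz t ht ▸ ht.symm) hTz how hoz
  -- `z` is outside the core, for otherwise `w` and `z` would form a component of `G`
  have hzQ : z ∉ pendantCore G X ∪ X := by
    rintro (⟨-, z', -, hz', hz''⟩ | h)
    · have : z' = w := hz z' hz'
      subst this
      exact hpz (hz'' p (hT.1 hp))
    · exact hzX h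
  refine ⟨p, q, hpq, hp, hq, ?_, ?_⟩
  · by_contra hc
    exact hpz (h w hw _ _ (hT.1 hp) hwz hc hzQ)
  · by_contra hc
    exact hqz (h w hw _ _ (hT.1 hq) hwz hc hzQ)

theorem OneVertexObstruction.not_hasHIST [Finite V] (h : OneVertexObstruction G) :
    ¬ HasHIST G := by
  rintro ⟨T, hT⟩
  obtain ⟨v, hne, htight⟩ := h
  refine hT.2.1.not_two_neighbors _ hne v (fun hv => hv.1 rfl) fun w hw => ?_
  obtain ⟨p, q, hpq, hp, hq, hpQ, hqQ⟩ := htight.two_neighbors hT (Set.singleton_nonempty v) hw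
  exact ⟨p, q, hpq, hp, hq, hpQ, hqQ⟩

/-- The degree-two vertex of a roof is not a leaf at `u`, since `u` would then behave like a
vertex of the core. -/
theorem IsRoof.not_leaf_left [Finite V] {u v y : V} (h : IsRoof G u v y) (hT : IsHIST G T)
    (hyu : T.Adj y u) (hy : ∀ t, T.Adj y t → t = u) : False := by
  have hGu := (h.adj_iff u).2 (Or.inl rfl)
  have hGv := (h.adj_iff v).2 (Or.inr rfl)
  refine hT.2.1.not_two_neighbors (insert u (pendantCore G {u, v})) ⟨u, Or.inl rfl⟩ v ?_ ?_
  · rintro (h' | h')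
    · exact h.ne h'.symm
    · exact h'.1 (by simp)
  · rintro w (rfl | hw)
    · obtain ⟨p, q, hpq, hpy, hqy, hp, hq⟩ := hT.two_more hyu.symm hy h.ne.symm hGv.ne'
      have := h.left p (hT.1 hp)
      have := h.left q (hT.1 hq)
      exact ⟨p, q, hpq, hp, hq, by simp; tauto, by simp; tauto⟩
    · obtain ⟨p, q, hpq, hp, hq, hpQ, hqQ⟩ := h.tight.two_neighbors hT ⟨u, by simp⟩ hw
      simp only [Set.mem_union, Set.mem_insert_iff, Set.mem_singleton_iff] at hpQ hqQ
      exact ⟨p, q, hpq, hp, hq, by simp; tauto, by simp; tauto⟩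

theorem IsRoof.not_hasHIST [Finite V] {u v y : V} (h : IsRoof G u v y) : ¬ HasHIST G := by
  rintro ⟨T, hT⟩
  rcases hT.leaf_of_two h.ne h.adj_iff with ⟨h1, h2⟩ | ⟨h1, h2⟩
  · exact h.not_leaf_left hT h1 h2
  · exact h.symm.not_leaf_left hT h1 h2

namespace IsHorned

variable {x a b y y' : V}

theorem adj_xa (h : IsHorned G x a b y y') : G.Adj x a := (h.adj_x a).2 (Or.inl rfl)

theorem adj_ya (h : IsHorned G x a b y y') : G.Adj y a := (h.adj_y a).2 (Or.inr rfl)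

theorem x_notMem (h : IsHorned G x a b y y') : x ∉ pendantCore G {a, b} := by
  rintro ⟨-, z, hz, hxz, hz'⟩
  simp only [Set.mem_insert_iff, Set.mem_singleton_iff, not_or] at hz
  rcases (h.adj_x z).1 hxz with h1 | h1 | rfl | rfl
  · exact hz.1 h1
  · exact hz.2 h1
  · exact h.adj_xa.ne (hz' a h.adj_ya).symm
  · exact h.symm.adj_xa.ne (hz' b h.symm.adj_ya).symm

theorem y_notMem (h : IsHorned G x a b y y') : y ∉ pendantCore G {a, b} := by
  rintro ⟨-, z, hz, hyz, hz'⟩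
  simp only [Set.mem_insert_iff, Set.mem_singleton_iff, not_or] at hz
  rcases (h.adj_y z).1 hyz with rfl | h1
  · exact h.adj_ya.ne (hz' a h.adj_xa).symm
  · exact hz.1 h1

/-- The horns are not leaves at `a` and `b`: the core with `a` and `b` would have two neighbours
per vertex, with `x` as the further vertex. -/
theorem not_leaf_left_right [Finite V] (h : IsHorned G x a b y y') (hT : IsHIST G T)
    (hya : T.Adj y a) (hy : ∀ t, T.Adj y t → t = a) (hyb : T.Adj y' b)
    (hy' : ∀ t, T.Adj y' t → t = b) : False := by
  refine hT.2.1.not_two_neighbors (insert a (insert b (pendantCore G {a, b}))) ⟨a, Or.inl rfl⟩ x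
    ?_ ?_
  · rintro (h' | h' | h')
    · exact h.adj_xa.ne h'
    · exact h.symm.adj_xa.ne h'
    · exact h.x_notMem h'
  · rintro w (rfl | rfl | hw)
    · obtain ⟨p, q, hpq, hpy, hqy, hp, hq⟩ := hT.two_more hya.symm hy h.ne.symm h.y_ne.symm
      have := h.left p (hT.1 hp)
      have := h.left q (hT.1 hq)
      exact ⟨p, q, hpq, hp, hq, by simp; tauto, by simp; tauto⟩
    · obtain ⟨p, q, hpq, hpy, hqy, hp, hq⟩ := hT.two_more hyb.symm hy' h.ne h.y'_ne.symm
      have := h.right p (hT.1 hp)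
      have := h.right q (hT.1 hq)
      exact ⟨p, q, hpq, hp, hq, by simp; tauto, by simp; tauto⟩
    · obtain ⟨p, q, hpq, hp, hq, hpQ, hqQ⟩ := h.tight.two_neighbors hT ⟨a, by simp⟩ hw
      simp only [Set.mem_union, Set.mem_insert_iff, Set.mem_singleton_iff] at hpQ hqQ
      exact ⟨p, q, hpq, hp, hq, by simp; tauto, by simp; tauto⟩

/-- The horns are not leaves at `x` and `b`: the core with `x` and `b` would have two neighbours
per vertex, with `a` as the further vertex. -/
theorem not_leaf_top_right [Finite V] (h : IsHorned G x a b y y') (hT : IsHIST G T)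
    (hyx : T.Adj y x) (hy : ∀ t, T.Adj y t → t = x) (hyb : T.Adj y' b)
    (hy' : ∀ t, T.Adj y' t → t = b) : False := by
  refine hT.2.1.not_two_neighbors (insert x (insert b (pendantCore G {a, b}))) ⟨x, Or.inl rfl⟩ a
    ?_ ?_
  · rintro (h' | h' | h')
    · exact h.adj_xa.ne h'.symm
    · exact h.ne h'
    · exact h'.1 (by simp)
  · rintro w (rfl | rfl | hw)
    · obtain ⟨p, q, hpq, hpy, hqy, hp, hq⟩ := hT.two_more hyx.symm hy h.adj_xa.ne' h.adj_ya.ne'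
      have hsub : ∀ p, T.Adj w p → p ≠ y → p = a ∨ p = b := by
        intro p hp hpy
        rcases (h.adj_x p).1 (hT.1 hp) with h1 | h1 | h1 | rfl
        · exact Or.inl h1
        · exact Or.inr h1
        · exact absurd h1 hpy
        · exact absurd (hy' w hp.symm) h.symm.adj_xa.ne
      have := hsub p hp hpy
      have := hsub q hq hqy
      exact ⟨p, q, hpq, hp, hq, by simp; tauto, by simp; tauto⟩
    · obtain ⟨p, q, hpq, hpy, hqy, hp, hq⟩ := hT.two_more hyb.symm hy' h.ne h.y'_ne.symm
      have := h.right p (hT.1 hp)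
      have := h.right q (hT.1 hq)
      exact ⟨p, q, hpq, hp, hq, by simp; tauto, by simp; tauto⟩
    · obtain ⟨p, q, hpq, hp, hq, hpQ, hqQ⟩ := h.tight.two_neighbors hT ⟨a, by simp⟩ hw
      simp only [Set.mem_union, Set.mem_insert_iff, Set.mem_singleton_iff] at hpQ hqQ
      exact ⟨p, q, hpq, hp, hq, by simp; tauto, by simp; tauto⟩

/-- If the horn `y` is a leaf at `x`, then `a` cannot join `x` to the rest of the tree: `a` needs a
third neighbour, and the core with `a`, together with `x` if `x` sees `b`, would have two neighbours
per vertex, with `b` as the further vertex. -/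
theorem not_adj_top_left [Finite V] (h : IsHorned G x a b y y') (hT : IsHIST G T)
    (hy : ∀ t, T.Adj y t → t = x) (hxa : T.Adj x a) {t : V} (hat : T.Adj a t) (htx : t ≠ x) :
    False := by
  obtain ⟨s, hsx, hst, has⟩ := exists_third_neighbor (hT.2.2 a) htx.symm hxa.symm hat
  have hsub : ∀ s, T.Adj a s → s ≠ x → s ∈ pendantCore G {a, b} ∨ s = b := by
    intro s has hsx
    rcases h.left s (hT.1 has) with h1 | h1 | h1 | rfl
    · exact Or.inl h1
    · exact Or.inr h1
    · exact absurd h1 hsx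
    · exact absurd (hy a has.symm) h.adj_xa.ne'
  have ht := hsub t hat htx
  have hs := hsub s has hsx
  have hb : b ∉ pendantCore G {a, b} := fun hb => hb.1 (by simp)
  have hcore : ∀ w ∈ pendantCore G {a, b}, ∃ p q, p ≠ q ∧ T.Adj w p ∧ T.Adj w q ∧
      (p = a ∨ p ∈ pendantCore G {a, b} ∨ p = b) ∧
      (q = a ∨ q ∈ pendantCore G {a, b} ∨ q = b) := by
    intro w hw
    obtain ⟨p, q, hpq, hp, hq, hpQ, hqQ⟩ := h.tight.two_neighbors hT ⟨a, by simp⟩ hw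
    simp only [Set.mem_union, Set.mem_insert_iff, Set.mem_singleton_iff] at hpQ hqQ
    exact ⟨p, q, hpq, hp, hq, by tauto, by tauto⟩
  by_cases hxb : T.Adj x b
  · refine hT.2.1.not_two_neighbors (insert x (insert a (pendantCore G {a, b}))) ⟨x, Or.inl rfl⟩ b
      ?_ ?_
    · rintro (h' | h' | h')
      · exact h.symm.adj_xa.ne h'.symm
      · exact h.ne h'.symm
      · exact hb h'
    · rintro w (rfl | rfl | hw)
      · exact ⟨a, b, h.ne, hxa, hxb, by simp, by simp⟩
      · exact ⟨t, s, hst.symm, hat, has, by simp; tauto, by simp; tauto⟩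
      · obtain ⟨p, q, hpq, hp, hq, hpQ, hqQ⟩ := hcore w hw
        exact ⟨p, q, hpq, hp, hq, by simp; tauto, by simp; tauto⟩
  · refine hT.2.1.not_two_neighbors (insert a (pendantCore G {a, b})) ⟨a, Or.inl rfl⟩ b ?_ ?_
    · rintro (h' | h')
      · exact h.ne h'.symm
      · exact hb h'
    · rintro w (rfl | hw)
      · exact ⟨t, s, hst.symm, hat, has, by simp; tauto, by simp; tauto⟩
      · obtain ⟨p, q, hpq, hp, hq, hpQ, hqQ⟩ := hcore w hw
        exact ⟨p, q, hpq, hp, hq, by simp; tauto, by simp; tauto⟩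

theorem not_hasHIST [Finite V] (h : IsHorned G x a b y y') : ¬ HasHIST G := by
  rintro ⟨T, hT⟩
  rcases hT.leaf_of_two h.adj_xa.ne h.adj_y with ⟨h1, h2⟩ | ⟨h1, h2⟩ <;>
    rcases hT.leaf_of_two h.symm.adj_xa.ne h.adj_y' with ⟨h3, h4⟩ | ⟨h3, h4⟩
  · -- both horns are leaves at `x`; the rest of the tree hangs on `a` or `b`
    obtain ⟨r, hr⟩ := h.nonempty
    have hrS : r ∉ {c | c = x ∨ c = y ∨ c = y' ∨ (T.Adj x c ∧ (c = a ∨ c = b))} := by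
      rintro (rfl | rfl | rfl | ⟨-, rfl | rfl⟩)
      · exact h.x_notMem hr
      · exact h.y_notMem hr
      · exact h.symm.y_notMem (Set.pair_comm a b ▸ hr)
      · exact hr.1 (by simp)
      · exact hr.1 (by simp)
    obtain ⟨s, hs, t, ht, hst⟩ := hT.2.1.connected.exists_adj_boundary
      {c | c = x ∨ c = y ∨ c = y' ∨ (T.Adj x c ∧ (c = a ∨ c = b))} (a := x) (Or.inl rfl) hrS
    simp only [Set.mem_ofPred_eq, not_or] at hs ht
    rcases hs with rfl | rfl | rfl | ⟨hxs, rfl | rfl⟩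
    · have := (h.adj_x t).1 (hT.1 hst)
      tauto
    · exact ht.1 (h2 t hst)
    · exact ht.1 (h4 t hst)
    · exact h.not_adj_top_left hT h2 hxs hst ht.1
    · exact h.symm.not_adj_top_left hT h4 hxs hst ht.1
  · exact h.not_leaf_top_right hT h1 h2 h3 h4
  · exact h.symm.not_leaf_top_right hT h3 h4 h1 h2
  · exact h.not_leaf_left_right hT h1 h2 h3 h4

end IsHorned

theorem IsObstructed.not_hasHIST [Finite V] (h : IsObstructed G) : ¬ HasHIST G := by
  rcases h with h | ⟨u, v, y, h⟩ | ⟨x, a, b, y, y', h⟩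
  · exact h.not_hasHIST
  · exact h.not_hasHIST
  · exact h.not_hasHIST

end Trees

/-! ### Constructing homeomorphically irreducible spanning trees -/

section Constructions

variable {V : Type*} {G : SimpleGraph V}

/-- The graph whose edges join every vertex but the root to its parent. -/
def parentGraph (root : V) (par : V → V) (h : ∀ x, x ≠ root → par x ≠ x) : SimpleGraph V where
  Adj a b := (a ≠ root ∧ par a = b) ∨ (b ≠ root ∧ par b = a)
  symm := ⟨fun _ _ hab => hab.symm⟩
  loopless := ⟨fun a ha => by
    rcases ha with ⟨h1, h2⟩ | ⟨h1, h2⟩ <;> exact h a h1 h2⟩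

theorem parentGraph_isTree [Finite V] (root : V) (par : V → V) (rank : V → ℕ)
    (hrank : ∀ x, x ≠ root → rank (par x) < rank x) (h : ∀ x, x ≠ root → par x ≠ x) :
    (parentGraph root par h).IsTree := by
  have hreach : ∀ n x, rank x = n → (parentGraph root par h).Reachable x root := by
    intro n
    induction n using Nat.strong_induction_on with
    | _ n ih =>
      intro x hx
      by_cases hxr : x = root
      · rw [hxr]
      · have hadj : (parentGraph root par h).Adj x (par x) := Or.inl ⟨hxr, rfl⟩
        exact hadj.reachable.trans (ih _ (hx ▸ hrank x hxr) _ rfl)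
  have : Nonempty V := ⟨root⟩
  have hconn : (parentGraph root par h).Connected :=
    { preconnected := fun a b => (hreach _ a rfl).trans (hreach _ b rfl).symm }
  rw [SimpleGraph.isTree_iff_connected_and_card]
  refine ⟨hconn, le_antisymm ?_ hconn.card_vert_le_card_edgeSet_add_one⟩
  have hsub : (parentGraph root par h).edgeSet ⊆ (fun x => s(x, par x)) '' {root}ᶜ := by
    intro e he
    induction e with
    | _ a b =>
      rcases he with ⟨h1, h2⟩ | ⟨h1, h2⟩
      · exact ⟨a, h1, congrArg (s(a, ·)) h2⟩
      · exact ⟨b, h1, (congrArg (s(b, ·)) h2).trans Sym2.eq_swap⟩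
  have h1 := (Set.ncard_le_ncard hsub (Set.toFinite _)).trans (Set.ncard_image_le (Set.toFinite _))
  have h2 := Set.ncard_add_ncard_compl ({root} : Set V)
  rw [Set.ncard_singleton] at h2
  have h3 : Nat.card (parentGraph root par h).edgeSet =
      (parentGraph root par h).edgeSet.ncard := rfl
  omega

/-- A HIST, given by a root and a parent function along which `rank` decreases: the root must not
have two children, and no other vertex may have a single child. -/
theorem hasHIST_of_parent [Finite V] (root : V) (par : V → V) (rank : V → ℕ)
    (hadj : ∀ x, x ≠ root → G.Adj x (par x)) (hrank : ∀ x, x ≠ root → rank (par x) < rank x)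
    (hroot : {c | c ≠ root ∧ par c = root}.ncard ≠ 2)
    (hother : ∀ v c, v ≠ root → c ≠ root → par c = v → ∃ c', c' ≠ c ∧ c' ≠ root ∧ par c' = v) :
    HasHIST G := by
  refine ⟨parentGraph root par fun x hx => (hadj x hx).ne', ?_,
    parentGraph_isTree root par rank hrank _, fun v hv => ?_⟩
  · rintro a b (⟨h1, rfl⟩ | ⟨h1, rfl⟩)
    · exact hadj a h1
    · exact (hadj b h1).symm
  · by_cases hvr : v = root
    · subst hvr
      refine hroot ?_
      rw [← hv]
      congr 1
      ext c
      exact ⟨fun h => Or.inr h, fun h => h.elim (fun h => absurd rfl h.1) id⟩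
    · obtain ⟨p, q, hpq, hset⟩ := Set.ncard_eq_two.1 hv
      have hmem : ∀ t, ((v ≠ root ∧ par v = t) ∨ (t ≠ root ∧ par t = v)) ↔ t = p ∨ t = q := by
        intro t
        have : t ∈ ({p, q} : Set V) ↔ t = p ∨ t = q := by simp
        rw [← this, ← hset]
        rfl
      have hchild : ∀ c, c ≠ root → par c = v → c ≠ par v := by
        rintro c hc rfl h
        have h1 := hrank c hc
        have h2 := hrank _ hvr
        rw [← h] at h2
        omega
      -- the parent and two children of `v` would be three different neighbours
      have key : ∀ c, c ≠ root → par c = v → False := by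
        intro c hc hcv
        obtain ⟨c', h1, h2, h3⟩ := hother v c hvr hc hcv
        have e1 := (hmem c).1 (Or.inr ⟨hc, hcv⟩)
        have e2 := (hmem c').1 (Or.inr ⟨h2, h3⟩)
        have e3 := (hmem (par v)).1 (Or.inl ⟨hvr, rfl⟩)
        have n1 := hchild c hc hcv
        have n2 := hchild c' h2 h3
        grind
      rcases (hmem p).2 (Or.inl rfl) with ⟨-, hp⟩ | ⟨h1, h2⟩
      · rcases (hmem q).2 (Or.inr rfl) with ⟨-, hq⟩ | ⟨h1, h2⟩
        · exact hpq (hp.symm.trans hq)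
        · exact key q h1 h2
      · exact key p h1 h2

/-- A vertex adjacent to all others is the centre of a spanning star, which is a HIST unless there
are three vertices. -/
theorem hasHIST_of_universal [Finite V] (u : V) (hu : ∀ x, x ≠ u → G.Adj x u)
    (hcard : Nat.card V ≠ 3) : HasHIST G := by
  classical
  refine hasHIST_of_parent u (fun _ => u) (fun x => if x = u then 0 else 1) hu ?_ ?_ ?_
  · intro x hx
    simp [hx]
  · have h1 : {c : V | c ≠ u ∧ u = u} = ({u} : Set V)ᶜ := by ext; simp
    have h2 := Set.ncard_add_ncard_compl ({u} : Set V)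
    rw [Set.ncard_singleton] at h2
    rw [h1]
    omega
  · rintro v c hv - rfl
    exact absurd rfl hv

/-- A caterpillar is a HIST if every vertex of its spine `a, m, b` carries a leaf, and the ends
`a` and `b` carry two. Here `f` sends the leaves to the vertices of the spine. -/
theorem hasHIST_of_caterpillar [Finite V] (a b : V) (m : List V) (hnd : (a :: (m ++ [b])).Nodup)
    (hchain : (a :: (m ++ [b])).IsChain G.Adj) (f : V → V)
    (hf : ∀ x ∉ a :: (m ++ [b]), f x ∈ a :: (m ++ [b]) ∧ G.Adj x (f x))
    (hleaf : ∀ v ∈ a :: (m ++ [b]), ∃ x ∉ a :: (m ++ [b]), f x = v)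
    (ha : ∃ x y, x ≠ y ∧ x ∉ a :: (m ++ [b]) ∧ y ∉ a :: (m ++ [b]) ∧ f x = a ∧ f y = a)
    (hb : ∃ x y, x ≠ y ∧ x ∉ a :: (m ++ [b]) ∧ y ∉ a :: (m ++ [b]) ∧ f x = b ∧ f y = b) :
    HasHIST G := by
  classical
  obtain ⟨l, hl⟩ : ∃ l, l = a :: (m ++ [b]) := ⟨_, rfl⟩
  rw [← hl] at hnd hchain hf hleaf ha hb
  have hlen : 2 ≤ l.length := by simp [hl]
  have hal : a ∈ l := by simp [hl]
  have hl0 : l[0] = a := by simp [hl]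
  have hlast : l[l.length - 1] = b := by
    have : l.getLast (by simp [hl]) = b := by simp [hl]
    rw [← this, List.getLast_eq_getElem]
  have hidx : ∀ i (hi : i < l.length), l.idxOf l[i] = i := fun i hi => hnd.idxOf_getElem i hi
  set par : V → V := fun x => if x ∈ l then l.getD (l.idxOf x - 1) a else f x with hpar
  have hpar_l : ∀ i (hi : i + 1 < l.length), par l[i + 1] = l[i] := by
    intro i hi
    simp only [hpar, List.getElem_mem, if_true, hidx, Nat.add_sub_cancel]
    exact List.getD_eq_getElem _ _ _
  have hpar_f : ∀ x, x ∉ l → par x = f x := fun x hx => by simp [hpar, hx]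
  have hcases : ∀ x, x ≠ a → x ∉ l ∨ ∃ i, ∃ hi : i + 1 < l.length, x = l[i + 1] := by
    intro x hx
    by_cases hxl : x ∈ l
    · obtain ⟨i, hi, rfl⟩ := List.mem_iff_getElem.1 hxl
      match i, hi with
      | 0, _ => exact absurd hl0 hx
      | i + 1, hi => exact Or.inr ⟨i, hi, rfl⟩
    · exact Or.inl hxl
  have hne : ∀ i (hi : i + 1 < l.length), l[i + 1] ≠ a := by
    intro i hi h
    have := hidx (i + 1) hi
    rw [h, ← hl0, hidx 0 (by omega)] at this
    omega
  have hxa : ∀ x, x ∉ l → x ≠ a := by rintro x hx rfl; exact hx hal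
  refine hasHIST_of_parent a par l.idxOf ?_ ?_ ?_ ?_
  · intro x hx
    rcases hcases x hx with h | ⟨i, hi, rfl⟩
    · rw [hpar_f x h]; exact (hf x h).2
    · rw [hpar_l i hi]; exact (List.isChain_iff_getElem.1 hchain i hi).symm
  · intro x hx
    rcases hcases x hx with h | ⟨i, hi, rfl⟩
    · rw [hpar_f x h, List.idxOf_eq_length h]
      exact List.idxOf_lt_length_of_mem (hf x h).1
    · rw [hpar_l i hi, hidx, hidx]; exact Nat.lt_succ_self i
  · obtain ⟨x, y, hxy, hx, hy, hfx, hfy⟩ := ha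
    intro h2
    obtain ⟨p, q, -, hset⟩ := Set.ncard_eq_two.1 h2
    have hmem : ∀ t, t ≠ a → par t = a → t = p ∨ t = q := by
      intro t h1 h2
      have : t ∈ {c | c ≠ a ∧ par c = a} := ⟨h1, h2⟩
      rw [hset] at this
      simpa using this
    have e1 := hmem x (hxa x hx) ((hpar_f x hx).trans hfx)
    have e2 := hmem y (hxa y hy) ((hpar_f y hy).trans hfy)
    have e3 := hmem (l[0 + 1]'(by omega)) (hne 0 (by omega)) ((hpar_l 0 (by omega)).trans hl0)
    have n1 : x ≠ l[0 + 1]'(by omega) := by rintro h; exact hx (h ▸ List.getElem_mem _)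
    have n2 : y ≠ l[0 + 1]'(by omega) := by rintro h; exact hy (h ▸ List.getElem_mem _)
    grind
  · rintro v c hva hca rfl
    have hvl : par c ∈ l := by
      rcases hcases c hca with h | ⟨i, hi, rfl⟩
      · rw [hpar_f c h]; exact (hf c h).1
      · rw [hpar_l i hi]; exact List.getElem_mem _
    by_cases hcl : c ∈ l
    · obtain ⟨x, hx, hfx⟩ := hleaf _ hvl
      exact ⟨x, by rintro rfl; exact hx hcl, hxa x hx, (hpar_f x hx).trans hfx⟩
    obtain ⟨i, hi, hiv⟩ := List.mem_iff_getElem.1 hvl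
    by_cases hi' : i + 1 < l.length
    · exact ⟨l[i + 1], fun h => hcl (h ▸ List.getElem_mem _), hne i hi', (hpar_l i hi').trans hiv⟩
    · have : i = l.length - 1 := by omega
      subst this
      have hvb : par c = b := hiv.symm.trans hlast
      obtain ⟨x, y, hxy, hx, hy, hfx, hfy⟩ := hb
      by_cases hxc : x = c
      · exact ⟨y, fun h => hxy (hxc.trans h.symm), hxa y hy, by rw [hpar_f y hy, hfy, hvb]⟩
      · exact ⟨x, hxc, hxa x hx, by rw [hpar_f x hx, hfx, hvb]⟩

theorem SimpleGraph.IsClique.isChain {K : Set V} (hK : G.IsClique K) {l : List V} (hl : l.Nodup)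
    (h : ∀ x ∈ l, x ∈ K) : l.IsChain G.Adj :=
  (List.Pairwise.imp_of_mem (fun hx hy hxy => hK (h _ hx) (h _ hy) hxy) hl).isChain

end Constructions

/-! ### Chordal graphs with a dominating clique -/

section Dichotomy

variable {V : Type*} {G : SimpleGraph V}

/-- `K` is a dominating clique with at least two vertices, and `y` chooses for every `w ∈ K` a
private neighbour: a vertex outside `K` whose only neighbour in `K` is `w`. -/
structure IsPrivateFrame (G : SimpleGraph V) (K : Set V) (y : V → V) : Prop where
  clique : G.IsClique K
  nontrivial : K.Nontrivial
  exists_adj : ∀ x ∉ K, ∃ k ∈ K, G.Adj x k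
  notMem : ∀ w ∈ K, y w ∉ K
  adj : ∀ w ∈ K, G.Adj w (y w)
  eq_of_adj : ∀ w ∈ K, ∀ k ∈ K, G.Adj (y w) k → k = w

/-- A vertex outside the frame: neither in `K` nor one of the chosen private neighbours. -/
def IsExtra (K : Set V) (y : V → V) (r : V) : Prop :=
  r ∉ K ∧ ∀ w ∈ K, r ≠ y w

namespace IsPrivateFrame

variable {K : Set V} {y : V → V}

theorem cases (_ : IsPrivateFrame G K y) (x : V) : x ∈ K ∨ (∃ w ∈ K, x = y w) ∨ IsExtra K y x := by
  by_cases hx : x ∈ K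
  · exact Or.inl hx
  · by_cases hy : ∃ w ∈ K, x = y w
    · exact Or.inr (Or.inl hy)
    · push Not at hy
      exact Or.inr (Or.inr ⟨hx, hy⟩)

theorem injOn (h : IsPrivateFrame G K y) {w w' : V} (hw : w ∈ K) (hw' : w' ∈ K)
    (he : y w = y w') : w = w' :=
  h.eq_of_adj w' hw' w hw (he ▸ (h.adj w hw).symm)

/-- The neighbour of a pendant vertex lies in every dominating clique that has two vertices. -/
theorem mem_of_isPendant (h : IsPrivateFrame G K y) {w z : V} (hz : IsPendant G w z) : w ∈ K := by
  by_cases hzK : z ∈ K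
  · obtain ⟨k, hk, hkz⟩ := h.nontrivial.exists_ne z
    exact hz.2 k (h.clique hzK hk hkz.symm) ▸ hk
  · obtain ⟨k, hk, hzk⟩ := h.exists_adj z hzK
    exact hz.2 k hzk ▸ hk

/-- A neighbour of `y w` outside `K` sees `w`, as otherwise there would be a chordless cycle of
length four. -/
theorem adj_of_adj_private (h : IsPrivateFrame G K y) (hG : IsChordal G) {r w : V} (hr : r ∉ K)
    (hw : w ∈ K) (hrw : G.Adj r (y w)) : G.Adj r w := by
  obtain ⟨k, hk, hrk⟩ := h.exists_adj r hr
  by_cases hkw : k = w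
  · exact hkw ▸ hrk
  · rcases hG.adj_of_square hrw (h.adj w hw).symm (h.clique hw hk (Ne.symm hkw)) hrk.symm
      (by rintro rfl; exact hr hw) (by rintro rfl; exact h.notMem w hw hk) with h' | h'
    · exact h'
    · exact absurd (h.eq_of_adj w hw k hk h') hkw

theorem not_adj_private (h : IsPrivateFrame G K y) (hG : IsChordal G) {w w' : V} (hw : w ∈ K)
    (hw' : w' ∈ K) : ¬ G.Adj (y w) (y w') := by
  intro hadj
  have := h.eq_of_adj w hw w' hw' (h.adj_of_adj_private hG (h.notMem w hw) hw' hadj)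
  subst this
  exact hadj.ne rfl

theorem isPendant (h : IsPrivateFrame G K y) (hG : IsChordal G) {w : V} (hw : w ∈ K)
    (hex : ∀ r, IsExtra K y r → ¬ G.Adj r (y w)) : IsPendant G w (y w) := by
  refine ⟨h.adj w hw, fun x hx => ?_⟩
  rcases h.cases x with hxK | ⟨w', hw', rfl⟩ | hxr
  · exact h.eq_of_adj w hw x hxK hx
  · exact absurd hx (h.not_adj_private hG hw hw')
  · exact absurd hx.symm (hex x hxr)

/-- The core with respect to `X` is `K \ X`, if no vertex outside the frame sees a
private neighbour of `K \ X`. -/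
theorem pendantCore_eq (h : IsPrivateFrame G K y) (hG : IsChordal G) (X : Set V)
    (hX : ∀ w ∈ K, w ∉ X → y w ∉ X)
    (hex : ∀ w ∈ K, w ∉ X → ∀ r, IsExtra K y r → ¬ G.Adj r (y w)) :
    pendantCore G X = K \ X := by
  ext w
  constructor
  · rintro ⟨hwX, z, -, hz⟩
    exact ⟨h.mem_of_isPendant hz, hwX⟩
  · rintro ⟨hwK, hwX⟩
    exact ⟨hwX, y w, hX w hwK hwX, h.isPendant hG hwK (hex w hwK hwX)⟩

theorem isTight (h : IsPrivateFrame G K y) {X : Set V} (hcore : pendantCore G X = K \ X)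
    (hex : ∀ w ∈ K, w ∉ X → ∀ r, IsExtra K y r → r ∉ X → ¬ G.Adj w r) : IsTight G X := by
  have key : ∀ w ∈ pendantCore G X, ∀ z, G.Adj w z → z ∉ pendantCore G X ∪ X → z = y w := by
    intro w hw z hwz hz
    rw [hcore] at hw hz
    simp only [Set.mem_union, Set.mem_sdiff, not_or, not_and, not_not] at hz
    rcases h.cases z with hzK | ⟨w', hw', rfl⟩ | hzr
    · exact absurd (hz.1 hzK) hz.2
    · rw [h.eq_of_adj w' hw' w hw.1 hwz.symm]
    · exact absurd hwz (hex w hw.1 hw.2 z hzr hz.2)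
  intro w hw z z' hz hz' hzn hzn'
  rw [key w hw z hz hzn, key w hw z' hz' hzn']

/-- An assignment of the vertices outside `K` to neighbours in `K`. -/
theorem exists_assignment (h : IsPrivateFrame G K y) :
    ∃ g : V → V, (∀ x ∉ K, g x ∈ K ∧ G.Adj x (g x)) ∧ ∀ w ∈ K, g (y w) = w := by
  choose! g hg using h.exists_adj
  exact ⟨g, hg, fun w hw => h.eq_of_adj w hw _ (hg _ (h.notMem w hw)).1 (hg _ (h.notMem w hw)).2⟩

/-- If two vertices outside the frame can be assigned to different vertices of `K`, then `K` has a
Hamiltonian path that is the spine of a suitable caterpillar. -/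
theorem hasHIST_of_two_extra [Finite V] (h : IsPrivateFrame G K y) {r r' w w' : V}
    (hr : IsExtra K y r) (hr' : IsExtra K y r') (hne : r ≠ r') (hw : w ∈ K) (hw' : w' ∈ K)
    (hww' : w ≠ w')
    (hrw : G.Adj r w) (hrw' : G.Adj r' w') : HasHIST G := by
  classical
  obtain ⟨g, hg, hgy⟩ := h.exists_assignment
  set m : List V := ((Set.toFinite (K \ {w, w'})).toFinset).toList with hm
  have hmem : ∀ x, x ∈ w :: (m ++ [w']) ↔ x ∈ K := by
    intro x
    simp only [hm, List.mem_cons, List.mem_append, Finset.mem_toList, Set.Finite.mem_toFinset,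
      Set.mem_sdiff, Set.mem_insert_iff, Set.mem_singleton_iff, List.not_mem_nil, or_false]
    constructor
    · rintro (rfl | h | rfl)
      exacts [hw, h.1, hw']
    · tauto
  have hnd : (w :: (m ++ [w'])).Nodup := by
    rw [List.nodup_cons, List.nodup_append]
    refine ⟨?_, Finset.nodup_toList _, by simp, ?_⟩
    · simp [hm, hww']
    · intro a ha b hb
      simp only [hm, Finset.mem_toList, Set.Finite.mem_toFinset, Set.mem_sdiff] at ha
      simp only [List.mem_singleton] at hb
      rintro rfl
      exact ha.2 (by simp [hb])
  set f : V → V := Function.update (Function.update g r w) r' w' with hf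
  have hfy : ∀ v ∈ K, f (y v) = v := by
    intro v hv
    rw [hf, Function.update_of_ne (hr'.2 v hv).symm, Function.update_of_ne (hr.2 v hv).symm,
      hgy v hv]
  have hfr : f r = w := by rw [hf, Function.update_of_ne hne, Function.update_self]
  have hfr' : f r' = w' := by rw [hf, Function.update_self]
  refine hasHIST_of_caterpillar w w' m hnd
    (h.clique.isChain hnd fun x hx => (hmem x).1 hx) f ?_ ?_ ?_ ?_
  · intro x hx
    rw [hmem] at hx ⊢
    by_cases h1 : x = r'
    · subst h1; rw [hfr']; exact ⟨hw', hrw'⟩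
    by_cases h2 : x = r
    · subst h2; rw [hfr]; exact ⟨hw, hrw⟩
    · rw [hf, Function.update_of_ne h1, Function.update_of_ne h2]
      exact hg x hx
  · intro v hv
    rw [hmem] at hv
    exact ⟨y v, by rw [hmem]; exact h.notMem v hv, hfy v hv⟩
  · exact ⟨r, y w, hr.2 w hw, by rw [hmem]; exact hr.1, by rw [hmem]; exact h.notMem w hw, hfr,
      hfy w hw⟩
  · exact ⟨r', y w', hr'.2 w' hw', by rw [hmem]; exact hr'.1, by rw [hmem]; exact h.notMem w' hw',
      hfr', hfy w' hw'⟩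

/-- If all vertices outside the frame are attached to the same vertex of `K`, this vertex is an
obstruction. -/
theorem oneVertexObstruction (h : IsPrivateFrame G K y) (hG : IsChordal G) {v : V} (hv : v ∈ K)
    (hex : ∀ r, IsExtra K y r → ∀ k ∈ K, G.Adj r k → k = v) : OneVertexObstruction G := by
  have hcore : pendantCore G {v} = K \ {v} := h.pendantCore_eq hG {v}
    (fun w hw _ hy => h.notMem w hw (by rw [Set.mem_singleton_iff.1 hy]; exact hv))
    (fun w hw hwv r hr hadj => hwv (hex r hr w hw (h.adj_of_adj_private hG hr.1 hw hadj)))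
  refine ⟨v, ?_, h.isTight hcore fun w hw hwv r hr _ hadj => hwv (hex r hr w hw hadj.symm)⟩
  rw [hcore]
  obtain ⟨k, hk, hkv⟩ := h.nontrivial.exists_ne v
  exact ⟨k, hk, hkv⟩

section OneExtra

variable {r : V}

/-- If no private neighbour sees the only vertex `r` outside the frame, then `r` is an
obstruction. -/
theorem oneVertexObstruction_of_extra (h : IsPrivateFrame G K y) (hG : IsChordal G)
    (hr : ∀ r', IsExtra K y r' ↔ r' = r) (hW : ∀ w ∈ K, ¬ G.Adj r (y w)) :
    OneVertexObstruction G := by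
  have hrx := (hr r).2 rfl
  have hcore : pendantCore G {r} = K \ {r} := h.pendantCore_eq hG {r}
    (fun w hw _ hy => hrx.2 w hw (Set.mem_singleton_iff.1 hy).symm)
    (fun w hw _ r' hr' => (hr r').1 hr' ▸ hW w hw)
  refine ⟨r, ?_, h.isTight hcore fun w hw _ r' hr' hne => absurd ((hr r').1 hr') hne⟩
  rw [hcore]
  obtain ⟨k, hk⟩ := h.nontrivial.nonempty
  exact ⟨k, hk, fun hkr => hrx.1 (Set.mem_singleton_iff.1 hkr ▸ hk)⟩

/-- If a single private neighbour sees the only vertex outside the frame, it is the ridge of a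
roof. -/
theorem isRoof (h : IsPrivateFrame G K y) (hG : IsChordal G)
    (hr : ∀ r', IsExtra K y r' ↔ r' = r) {w : V} (hw : w ∈ K) (hrw : G.Adj r (y w))
    (hW : ∀ w' ∈ K, G.Adj r (y w') → w' = w) : IsRoof G w r (y w) := by
  have hrx := (hr r).2 rfl
  have hcore : pendantCore G {w, r} = K \ {w, r} := h.pendantCore_eq hG {w, r}
    (by
      rintro v hv - (hy | hy)
      · exact h.notMem v hv (hy ▸ hw)
      · exact hrx.2 v hv hy.symm)
    (fun v hv hvw r' hr' hadj => hvw (Or.inl (hW v hv ((hr r').1 hr' ▸ hadj))))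
  have hcase : ∀ t, t ∈ K → t ∈ pendantCore G {w, r} ∨ t = w := by
    intro t ht
    rw [hcore]
    by_cases htw : t = w
    · exact Or.inr htw
    · refine Or.inl ⟨ht, ?_⟩
      rintro (h' | h')
      · exact htw h'
      · exact hrx.1 (Set.mem_singleton_iff.1 h' ▸ ht)
  refine ⟨by rintro rfl; exact hrx.1 hw, fun t => ⟨fun ht => ?_, ?_⟩,
    h.isTight hcore fun v hv _ r' hr' hne => absurd (Or.inr ((hr r').1 hr')) hne, fun t ht => ?_,
    fun t ht => ?_⟩
  · rcases h.cases t with htK | ⟨w', hw', rfl⟩ | htr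
    · exact Or.inl (h.eq_of_adj w hw t htK ht)
    · exact absurd ht (h.not_adj_private hG hw hw')
    · exact Or.inr ((hr t).1 htr)
  · rintro (rfl | rfl)
    · exact (h.adj _ hw).symm
    · exact hrw.symm
  · rcases h.cases t with htK | ⟨w', hw', rfl⟩ | htr
    · rcases hcase t htK with h' | rfl
      · exact Or.inl h'
      · exact absurd rfl ht.ne
    · rw [h.eq_of_adj w' hw' w hw ht.symm]; exact Or.inr (Or.inr rfl)
    · exact Or.inr (Or.inl ((hr t).1 htr))
  · rcases h.cases t with htK | ⟨w', hw', rfl⟩ | htr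
    · exact (hcase t htK).imp_right Or.inl
    · rw [hW w' hw' ht]; exact Or.inr (Or.inr rfl)
    · exact absurd ((hr t).1 htr).symm ht.ne

/-- If two private neighbours see the only vertex `r` outside the frame, and `r` has a third
neighbour `u` in `K`, then there is a caterpillar with spine `r`, `u`, …: it keeps the owners
`w₁` and `w₂` of these private neighbours as leaves at its other end. -/
theorem hasHIST_of_three_neighbors [Finite V] (h : IsPrivateFrame G K y)
    (hr : ∀ r', IsExtra K y r' ↔ r' = r) {w₁ w₂ u : V} (hw₁ : w₁ ∈ K) (hw₂ : w₂ ∈ K)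
    (hu : u ∈ K) (hne : w₁ ≠ w₂) (hu₁ : u ≠ w₁) (hu₂ : u ≠ w₂) (hr₁ : G.Adj r (y w₁))
    (hr₂ : G.Adj r (y w₂)) (hru : G.Adj r u) : HasHIST G := by
  classical
  have hrx := (hr r).2 rfl
  set l : List V := u :: ((Set.toFinite (K \ {w₁, w₂, u})).toFinset).toList with hl
  have hmem : ∀ x, x ∈ l ↔ x ∈ K ∧ x ≠ w₁ ∧ x ≠ w₂ := by
    intro x
    simp only [hl, List.mem_cons, Finset.mem_toList, Set.Finite.mem_toFinset,
      Set.mem_sdiff, Set.mem_insert_iff, Set.mem_singleton_iff]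
    constructor
    · rintro (rfl | h')
      · exact ⟨hu, hu₁, hu₂⟩
      · tauto
    · tauto
  have hlnd : l.Nodup := by
    rw [hl, List.nodup_cons]
    exact ⟨by simp, Finset.nodup_toList _⟩
  have hl0 : l ≠ [] := by simp [hl]
  obtain ⟨b, hb⟩ : ∃ b, b = l.getLast hl0 := ⟨_, rfl⟩
  have hlb : l.dropLast ++ [b] = l := by rw [hb]; exact List.dropLast_append_getLast hl0
  have hbl : b ∈ l := hb ▸ List.getLast_mem hl0
  have hbK := (hmem b).1 hbl
  have hmem' : ∀ x, x ∈ r :: (l.dropLast ++ [b]) ↔ x = r ∨ (x ∈ K ∧ x ≠ w₁ ∧ x ≠ w₂) := by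
    intro x
    rw [hlb, List.mem_cons, hmem]
  have hrl : r ∉ l := fun h' => hrx.1 ((hmem r).1 h').1
  obtain ⟨g, hg, hgy⟩ := h.exists_assignment
  set f : V → V := fun x => if x = y w₁ ∨ x = y w₂ then r else if x = w₁ ∨ x = w₂ then b else g x
    with hf
  have hy : ∀ v ∈ K, ∀ w ∈ K, y v ≠ w := by
    rintro v hv w hw rfl
    exact h.notMem v hv hw
  have hyn : ∀ v ∈ K, y v ∉ r :: (l.dropLast ++ [b]) := by
    intro v hv h'
    rcases (hmem' _).1 h' with h' | h'
    · exact hrx.2 v hv h'.symm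
    · exact h.notMem v hv h'.1
  have hwn : ∀ w, (w = w₁ ∨ w = w₂) → w ∉ r :: (l.dropLast ++ [b]) := by
    intro w hw h'
    rcases (hmem' _).1 h' with rfl | h'
    · rcases hw with rfl | rfl
      · exact hrx.1 hw₁
      · exact hrx.1 hw₂
    · tauto
  have hfy : ∀ v, v ∈ K ∧ v ≠ w₁ ∧ v ≠ w₂ → f (y v) = v := by
    rintro v ⟨hv, h1, h2⟩
    have e1 : y v ≠ y w₁ := fun he => h1 (h.injOn hv hw₁ he)
    have e2 : y v ≠ y w₂ := fun he => h2 (h.injOn hv hw₂ he)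
    simp only [hf, e1, e2, hy v hv w₁ hw₁, hy v hv w₂ hw₂, or_false, if_false, hgy v hv]
  have hfw : ∀ w, (w = w₁ ∨ w = w₂) → f w = b := by
    intro w hw
    have hwK : w ∈ K := by rcases hw with rfl | rfl <;> assumption
    simp only [hf, (hy w₁ hw₁ w hwK).symm, (hy w₂ hw₂ w hwK).symm, or_false, if_false, hw, if_true]
  have hfr : ∀ w, (w = w₁ ∨ w = w₂) → f (y w) = r := by
    rintro w (rfl | rfl) <;> simp [hf]
  refine hasHIST_of_caterpillar r b l.dropLast ?_ ?_ f ?_ ?_ ?_ ?_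
  · rw [hlb, List.nodup_cons]
    exact ⟨hrl, hlnd⟩
  · rw [hlb, hl, List.isChain_cons_cons]
    exact ⟨hru, h.clique.isChain hlnd fun x hx => ((hmem x).1 hx).1⟩
  · intro x hx
    rw [hmem'] at hx ⊢
    push Not at hx
    rcases h.cases x with hxK | ⟨v, hv, rfl⟩ | hxr
    · have hx' : x = w₁ ∨ x = w₂ := by
        by_contra! hc
        exact hc.2 (hx.2 hxK hc.1)
      rw [hfw x hx']
      refine ⟨Or.inr hbK, h.clique hxK hbK.1 ?_⟩
      rcases hx' with rfl | rfl
      · exact hbK.2.1.symm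
      · exact hbK.2.2.symm
    · by_cases hv' : v = w₁ ∨ v = w₂
      · rw [hfr v hv']
        refine ⟨Or.inl rfl, ?_⟩
        rcases hv' with rfl | rfl
        · exact hr₁.symm
        · exact hr₂.symm
      · push Not at hv'
        rw [hfy v ⟨hv, hv'⟩]
        exact ⟨Or.inr ⟨hv, hv'⟩, (h.adj v hv).symm⟩
    · exact absurd ((hr x).1 hxr) hx.1
  · intro v hv
    rcases (hmem' v).1 hv with rfl | hv'
    · exact ⟨y w₁, hyn w₁ hw₁, hfr w₁ (Or.inl rfl)⟩
    · exact ⟨y v, hyn v hv'.1, hfy v hv'⟩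
  · exact ⟨y w₁, y w₂, fun he => hne (h.injOn hw₁ hw₂ he), hyn w₁ hw₁, hyn w₂ hw₂,
      hfr w₁ (Or.inl rfl), hfr w₂ (Or.inr rfl)⟩
  · exact ⟨w₁, w₂, hne, hwn w₁ (Or.inl rfl), hwn w₂ (Or.inr rfl), hfw w₁ (Or.inl rfl),
      hfw w₂ (Or.inr rfl)⟩

/-- If `w₁` and `w₂` are the only neighbours in `K` of the only vertex `r` outside the frame, and
both their private neighbours see `r`, then `r` carries two horns. -/
theorem isHorned (h : IsPrivateFrame G K y) (hG : IsChordal G)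
    (hr : ∀ r', IsExtra K y r' ↔ r' = r) {w₁ w₂ v : V} (hw₁ : w₁ ∈ K) (hw₂ : w₂ ∈ K)
    (hne : w₁ ≠ w₂) (hr₁ : G.Adj r (y w₁)) (hr₂ : G.Adj r (y w₂))
    (hS : ∀ k ∈ K, G.Adj r k → k = w₁ ∨ k = w₂) (hv : v ∈ K) (hv₁ : v ≠ w₁) (hv₂ : v ≠ w₂) :
    IsHorned G r w₁ w₂ (y w₁) (y w₂) := by
  have hrx := (hr r).2 rfl
  have hW : ∀ w ∈ K, G.Adj r (y w) → w = w₁ ∨ w = w₂ := fun w hw hrw =>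
    hS w hw (h.adj_of_adj_private hG hrx.1 hw hrw)
  have hcore : pendantCore G {w₁, w₂} = K \ {w₁, w₂} := h.pendantCore_eq hG {w₁, w₂}
    (by
      rintro v hv - (hy | hy)
      · exact h.notMem v hv (hy ▸ hw₁)
      · exact h.notMem v hv (Set.mem_singleton_iff.1 hy ▸ hw₂))
    (fun v hv hvw r' hr' hadj => hvw (hW v hv ((hr r').1 hr' ▸ hadj)))
  have hcase : ∀ t, t ∈ K → t ∈ pendantCore G {w₁, w₂} ∨ t = w₁ ∨ t = w₂ := by
    intro t ht
    rw [hcore]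
    by_cases htw : t = w₁ ∨ t = w₂
    · exact Or.inr htw
    · exact Or.inl ⟨ht, htw⟩
  have hprivate : ∀ w ∈ K, G.Adj r (y w) → ∀ t, G.Adj (y w) t ↔ t = r ∨ t = w := by
    intro w hw hrw t
    constructor
    · intro ht
      rcases h.cases t with htK | ⟨w', hw', rfl⟩ | htr
      · exact Or.inr (h.eq_of_adj w hw t htK ht)
      · exact absurd ht (h.not_adj_private hG hw hw')
      · exact Or.inl ((hr t).1 htr)
    · rintro (rfl | rfl)
      · exact hrw.symm
      · exact (h.adj _ hw).symm
  refine ⟨hne, fun he => h.notMem w₁ hw₁ (he ▸ hw₂), fun he => h.notMem w₂ hw₂ (he ▸ hw₁),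
    hprivate w₁ hw₁ hr₁, hprivate w₂ hw₂ hr₂, fun t => ⟨fun ht => ?_, ?_⟩, ⟨v, ?_⟩,
    h.isTight hcore ?_, fun t ht => ?_, fun t ht => ?_⟩
  · rcases h.cases t with htK | ⟨w', hw', rfl⟩ | htr
    · have := hS t htK ht
      tauto
    · rcases hW w' hw' ht with rfl | rfl <;> simp
    · exact absurd ((hr t).1 htr).symm ht.ne
  · rintro (rfl | rfl | rfl | rfl)
    · exact h.adj_of_adj_private hG hrx.1 hw₁ hr₁
    · exact h.adj_of_adj_private hG hrx.1 hw₂ hr₂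
    · exact hr₁
    · exact hr₂
  · rw [hcore]
    exact ⟨hv, by simp [hv₁, hv₂]⟩
  · intro w hw hwX r' hr' _ hadj
    exact hwX (hS w hw ((hr r').1 hr' ▸ hadj.symm))
  · rcases h.cases t with htK | ⟨w', hw', rfl⟩ | htr
    · rcases hcase t htK with h' | rfl | rfl
      · exact Or.inl h'
      · exact absurd rfl ht.ne
      · exact Or.inr (Or.inl rfl)
    · rw [h.eq_of_adj w' hw' w₁ hw₁ ht.symm]; simp
    · exact Or.inr (Or.inr (Or.inl ((hr t).1 htr)))
  · rcases h.cases t with htK | ⟨w', hw', rfl⟩ | htr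
    · rcases hcase t htK with h' | rfl | rfl
      · exact Or.inl h'
      · exact Or.inr (Or.inl rfl)
      · exact absurd rfl ht.ne
    · rw [h.eq_of_adj w' hw' w₂ hw₂ ht.symm]; simp
    · exact Or.inr (Or.inr (Or.inl ((hr t).1 htr)))

end OneExtra

/-- The case analysis over the vertices outside the frame: if their attachment to `K` leaves any
freedom, there is a suitable caterpillar. -/
theorem hasHIST_or_isObstructed [Finite V] (h : IsPrivateFrame G K y) (hG : IsChordal G)
    (huniv : ∀ u, ∃ x, x ≠ u ∧ ¬ G.Adj x u) : HasHIST G ∨ IsObstructed G := by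
  by_contra! hcon
  obtain ⟨hno, hobs⟩ := hcon
  have hone : ¬ OneVertexObstruction G := fun h' => hobs (Or.inl h')
  -- some vertex `r` outside the frame has two neighbours in `K`
  have hspread : ∀ v ∈ K, ∃ r, IsExtra K y r ∧ ∃ k ∈ K, G.Adj r k ∧ k ≠ v := by
    intro v hv
    by_contra! hc
    exact hone (h.oneVertexObstruction hG hv hc)
  obtain ⟨v₀, hv₀⟩ := h.nontrivial.nonempty
  obtain ⟨r, hrx, k, hk, hrk, -⟩ := hspread v₀ hv₀
  obtain ⟨r', hrx', k', hk', hrk', hkk'⟩ := hspread k hk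
  obtain rfl : r = r' := by
    by_contra hne
    exact hno (h.hasHIST_of_two_extra hrx hrx' hne hk hk' hkk'.symm hrk hrk')
  -- and is the only vertex outside the frame
  have hr : ∀ r', IsExtra K y r' ↔ r' = r := by
    refine fun r' => ⟨fun hr' => ?_, fun he => he ▸ hrx⟩
    by_contra hne
    obtain ⟨l, hl, hrl⟩ := h.exists_adj r' hr'.1
    by_cases hlk : l = k
    · exact hno (h.hasHIST_of_two_extra hrx hr' (Ne.symm hne) hk' hl (hlk ▸ hkk') hrk' hrl)
    · exact hno (h.hasHIST_of_two_extra hrx hr' (Ne.symm hne) hk hl (Ne.symm hlk) hrk hrl)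
  have hW : ∃ w ∈ K, G.Adj r (y w) := by
    by_contra! hc
    exact hone (h.oneVertexObstruction_of_extra hG hr hc)
  obtain ⟨w₁, hw₁, hr₁⟩ := hW
  have hW' : ∃ w ∈ K, G.Adj r (y w) ∧ w ≠ w₁ := by
    by_contra! hc
    exact hobs (Or.inr (Or.inl ⟨_, _, _, h.isRoof hG hr hw₁ hr₁ hc⟩))
  obtain ⟨w₂, hw₂, hr₂, hne⟩ := hW'
  have hS : ∀ k ∈ K, G.Adj r k → k = w₁ ∨ k = w₂ := by
    intro u hu hru
    by_contra! hc
    exact hno (h.hasHIST_of_three_neighbors hr hw₁ hw₂ hu hne.symm hc.1 hc.2 hr₁ hr₂ hru)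
  by_cases hv : ∃ v ∈ K, v ≠ w₁ ∧ v ≠ w₂
  · obtain ⟨v, hv, hv₁, hv₂⟩ := hv
    exact hobs (Or.inr (Or.inr ⟨_, _, _, _, _,
      h.isHorned hG hr hw₁ hw₂ hne.symm hr₁ hr₂ hS hv hv₁ hv₂⟩))
  · -- otherwise `r` sees all five vertices
    push Not at hv
    have hK : ∀ w ∈ K, w = w₁ ∨ w = w₂ := by
      intro w hw
      by_cases hw' : w = w₁
      · exact Or.inl hw'
      · exact Or.inr (hv w hw hw')
    obtain ⟨x, hxr, hx⟩ := huniv r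
    refine hx ?_
    rcases h.cases x with hxK | ⟨w, hw, rfl⟩ | hxr'
    · rcases hK x hxK with rfl | rfl
      · exact (h.adj_of_adj_private hG hrx.1 hw₁ hr₁).symm
      · exact (h.adj_of_adj_private hG hrx.1 hw₂ hr₂).symm
    · rcases hK w hw with rfl | rfl
      · exact hr₁.symm
      · exact hr₂.symm
    · exact absurd ((hr x).1 hxr') hxr

end IsPrivateFrame

/-- A smallest dominating clique carries private neighbours, provided that it is not a single
vertex. -/
theorem exists_isPrivateFrame [Finite V] [Nonempty V] (huniv : ∀ u, ∃ x, x ≠ u ∧ ¬ G.Adj x u)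
    (hK : ∃ K : Set V, G.IsClique K ∧ ∀ x, IsDominated G K x) :
    ∃ (K : Set V) (y : V → V), IsPrivateFrame G K y := by
  classical
  have hex : ∃ n, ∃ K : Set V, K.ncard = n ∧ G.IsClique K ∧ ∀ x, IsDominated G K x := by
    obtain ⟨K, hK⟩ := hK
    exact ⟨_, K, rfl, hK⟩
  obtain ⟨K, hcard, hclique, hdom⟩ := Nat.find_spec hex
  have hadj : ∀ x ∉ K, ∃ k ∈ K, G.Adj x k := by
    intro x hx
    rcases hdom x with h | ⟨k, hk, hkx⟩
    · exact absurd h hx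
    · exact ⟨k, hk, hkx.symm⟩
  have hnt : K.Nontrivial := by
    by_contra hnt
    rw [Set.not_nontrivial_iff] at hnt
    obtain ⟨u, hu⟩ : K.Nonempty := by
      obtain ⟨x⟩ := ‹Nonempty V›
      rcases hdom x with h | ⟨k, hk, -⟩
      · exact ⟨x, h⟩
      · exact ⟨k, hk⟩
    obtain ⟨x, hxu, hx⟩ := huniv u
    obtain ⟨k, hk, hxk⟩ := hadj x fun hxK => hxu (hnt hxK hu)
    exact hx (hnt hk hu ▸ hxk)
  -- by minimality, `K` without `w` fails to dominate some vertex
  have hpriv : ∀ w ∈ K, ∃ y, y ∉ K ∧ G.Adj w y ∧ ∀ k ∈ K, G.Adj y k → k = w := by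
    intro w hw
    have hlt : (K \ {w}).ncard < Nat.find hex := by
      rw [← hcard]
      exact Set.ncard_sdiff_singleton_lt_of_mem hw (Set.toFinite _)
    have hnot : ¬ ∀ x, IsDominated G (K \ {w}) x := fun h' =>
      Nat.find_min hex hlt ⟨_, rfl, hclique.subset Set.sdiff_subset, h'⟩
    push Not at hnot
    obtain ⟨x, hx⟩ := hnot
    simp only [IsDominated, not_or, not_exists, not_and] at hx
    have hxK : x ∉ K := by
      intro hxK
      obtain ⟨k, hk, hkw⟩ := hnt.exists_ne w
      have hxw : x = w := by
        by_contra hxw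
        exact hx.1 ⟨hxK, hxw⟩
      exact hx.2 k ⟨hk, hkw⟩ (hxw ▸ hclique hk hw hkw)
    have hall : ∀ k ∈ K, G.Adj x k → k = w := by
      intro k hk hxk
      by_contra hkw
      exact hx.2 k ⟨hk, hkw⟩ hxk.symm
    obtain ⟨k, hk, hxk⟩ := hadj x hxK
    exact ⟨x, hxK, hall k hk hxk ▸ hxk.symm, hall⟩
  choose! y hy using hpriv
  exact ⟨K, y, hclique, hnt, hadj, fun w hw => (hy w hw).1, fun w hw => (hy w hw).2.1,
    fun w hw => (hy w hw).2.2⟩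

/-- A graph on three vertices, one of which sees the others, is a triangle or a path, and both are
obstructed. -/
theorem isObstructed_of_three {u : V} (hu : ∀ x, x ≠ u → G.Adj x u) (hcard : Nat.card V = 3) :
    IsObstructed G := by
  have h2 : ({u} : Set V)ᶜ.ncard = 2 := by
    have : Finite V := Nat.finite_of_card_ne_zero (by omega)
    have := Set.ncard_add_ncard_compl ({u} : Set V)
    rw [Set.ncard_singleton] at this
    omega
  obtain ⟨p, q, hpq, hset⟩ := Set.ncard_eq_two.1 h2
  have hall : ∀ x, x = u ∨ x = p ∨ x = q := by
    intro x
    by_cases hx : x = u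
    · exact Or.inl hx
    · have : x ∈ ({u} : Set V)ᶜ := hx
      rw [hset] at this
      exact Or.inr (by simpa using this)
  have hpu : p ≠ u := by
    have : p ∈ ({u} : Set V)ᶜ := by rw [hset]; simp
    simpa using this
  have hqu : q ≠ u := by
    have : q ∈ ({u} : Set V)ᶜ := by rw [hset]; simp
    simpa using this
  have hup := (hu p hpu).symm
  have huq := (hu q hqu).symm
  by_cases hadj : G.Adj p q
  · refine Or.inr (Or.inl ⟨p, q, u, hpq, fun t => ⟨fun ht => ?_, ?_⟩, ?_, fun t ht => ?_,
      fun t ht => ?_⟩)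
    · rcases hall t with rfl | h
      · exact absurd rfl ht.ne
      · exact h
    · rintro (rfl | rfl) <;> assumption
    · rintro w ⟨hw, z, hz, hwz⟩
      have e1 : w = u := by
        rcases hall w with h | rfl | rfl
        · exact h
        · simp at hw
        · simp at hw
      have e2 : z = u := by
        rcases hall z with h | rfl | rfl
        · exact h
        · simp at hz
        · simp at hz
      exact absurd (e1.trans e2.symm) hwz.1.ne
    · rcases hall t with rfl | rfl | rfl
      · exact Or.inr (Or.inr rfl)
      · exact absurd rfl ht.ne
      · exact Or.inr (Or.inl rfl)
    · rcases hall t with rfl | rfl | rfl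
      · exact Or.inr (Or.inr rfl)
      · exact Or.inr (Or.inl rfl)
      · exact absurd rfl ht.ne
  · have hq : IsPendant G u q := by
      refine ⟨huq, fun x hx => ?_⟩
      rcases hall x with rfl | rfl | rfl
      · rfl
      · exact absurd hx.symm hadj
      · exact absurd rfl hx.ne
    refine Or.inl ⟨p, ⟨u, by simpa using hpu.symm, q, by simpa using hpq.symm, hq⟩, ?_⟩
    rintro w ⟨hw, z, hz, hwz⟩ x x' hx hx' hxX hxX'
    simp only [Set.mem_singleton_iff] at hw hz
    have hwu : w = u := by
      rcases hall w with h | h | rfl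
      · exact h
      · exact absurd h hw
      · have := hq.2 z hwz.1
        subst this
        exact absurd (hwz.2 p hup) hpq
    subst hwu
    have key : ∀ x, G.Adj w x → x ∉ pendantCore G {p} ∪ {p} → x = q := by
      intro x hx hxX
      rcases hall x with rfl | rfl | rfl
      · exact absurd rfl hx.ne
      · exact absurd (Or.inr rfl) hxX
      · rfl
    rw [key x hx hxX, key x' hx' hxX']

/-- A chordal graph of diameter at most three has a HIST exactly if it is not obstructed. -/
theorem IsChordal.hasHIST_iff [Finite V] [Nonempty V] (hG : IsChordal G) (hd : G.ediam ≤ 3) :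
    HasHIST G ↔ ¬ IsObstructed G := by
  refine ⟨fun h h' => h'.not_hasHIST h, fun h => ?_⟩
  by_cases huniv : ∀ u, ∃ x, x ≠ u ∧ ¬ G.Adj x u
  · obtain ⟨K, y, hK⟩ := exists_isPrivateFrame huniv (hG.exists_dominating_clique hd)
    exact (hK.hasHIST_or_isObstructed hG huniv).resolve_right h
  · push Not at huniv
    obtain ⟨u, hu⟩ := huniv
    exact hasHIST_of_universal u hu fun hcard => h (isObstructed_of_three hu hcard)

end Dichotomy

/-! ### The obstructions as a first-order sentence -/

namespace Formula

/-- Disjunction. -/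
def or (φ ψ : Formula) : Formula := not (and (not φ) (not ψ))

/-- Implication. -/
def imp (φ ψ : Formula) : Formula := not (and φ (not ψ))

/-- Universal quantification. -/
def all (φ : Formula) : Formula := not (ex (not φ))

/-- The variable `i` is one of `xs`. -/
def mem (i : ℕ) : List ℕ → Formula
  | [] => not (eq i i)
  | x :: xs => or (eq i x) (mem i xs)

/-- The set of neighbours of `y` is contained in that of the variables `xs`. -/
def nbrsSubset (d y : ℕ) (xs : List ℕ) : Formula := all (imp (adj y d) (mem d xs))

/-- All of the variables `xs` are neighbours of `y`. -/
def adjAll (y : ℕ) : List ℕ → Formula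
  | [] => eq y y
  | x :: xs => and (adj y x) (adjAll y xs)

/-- The set of neighbours of `y` is that of the variables `xs`. -/
def nbrsEq (d y : ℕ) (xs : List ℕ) : Formula := and (nbrsSubset d y xs) (adjAll y xs)

/-- `w` is the only neighbour of `z`. -/
def pendant (d w z : ℕ) : Formula := and (adj w z) (all (imp (adj z d) (eq d w)))

/-- The variable `w` belongs to the core with respect to the variables `xs`. -/
def core (d : ℕ) (xs : List ℕ) (w : ℕ) : Formula :=
  and (not (mem w xs)) (ex (and (not (mem d xs)) (pendant (d + 1) w d)))

/-- The set of the variables `xs` is tight. -/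
def tight (d : ℕ) (xs : List ℕ) : Formula :=
  all (imp (core (d + 1) xs d) (all (all (imp (adj d (d + 1)) (imp (adj d (d + 2))
    (imp (not (or (core (d + 3) xs (d + 1)) (mem (d + 1) xs)))
      (imp (not (or (core (d + 3) xs (d + 2)) (mem (d + 2) xs))) (eq (d + 1) (d + 2)))))))))

/-- Every neighbour of `u` lies in the core with respect to `xs` or is one of `ys`. -/
def nbrsCore (d u : ℕ) (xs ys : List ℕ) : Formula :=
  all (imp (adj u d) (or (core (d + 1) xs d) (mem d ys)))

/-- There is an obstruction with one exceptional vertex. -/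
def oneVertex : Formula := ex (and (ex (core 2 [0] 1)) (tight 1 [0]))

/-- There is a roof; the variables `0`, `1`, `2` stand for `u`, `v`, `y`. -/
def roof : Formula :=
  ex (ex (ex (and (not (eq 0 1)) (and (nbrsEq 3 2 [0, 1]) (and (tight 3 [0, 1])
    (and (nbrsCore 3 0 [0, 1] [1, 2]) (nbrsCore 3 1 [0, 1] [0, 2])))))))

/-- There is an obstruction with two horns; the variables `0`, …, `4` stand for `x`, `a`, `b`, `y`,
`y'`. -/
def horned : Formula :=
  ex (ex (ex (ex (ex (and (not (eq 1 2)) (and (not (eq 3 2)) (and (not (eq 4 1))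
    (and (nbrsEq 5 3 [0, 1]) (and (nbrsEq 5 4 [0, 2]) (and (nbrsEq 5 0 [1, 2, 3, 4])
      (and (ex (core 6 [1, 2] 5)) (and (tight 5 [1, 2])
        (and (nbrsCore 5 1 [1, 2] [2, 0, 3]) (nbrsCore 5 2 [1, 2] [1, 0, 4]))))))))))))))

/-- The sentence that expresses `IsObstructed`. -/
def obstructed : Formula := or oneVertex (or roof horned)

section Semantics

variable {V : Type*} {G : SimpleGraph V} {d : ℕ} {e : ℕ → V}

@[simp] theorem holds_or {φ ψ : Formula} :
    (or φ ψ).Holds G d e ↔ φ.Holds G d e ∨ ψ.Holds G d e := by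
  simp only [or, Holds]; tauto

@[simp] theorem holds_imp {φ ψ : Formula} :
    (imp φ ψ).Holds G d e ↔ (φ.Holds G d e → ψ.Holds G d e) := by
  simp only [imp, Holds]; tauto

@[simp] theorem holds_all {φ : Formula} :
    (all φ).Holds G d e ↔ ∀ v, φ.Holds G (d + 1) (Function.update e d v) := by
  simp [all, Holds]

@[simp] theorem holds_mem {i : ℕ} {xs : List ℕ} :
    (mem i xs).Holds G d e ↔ e i ∈ xs.map e := by
  induction xs with
  | nil => simp [mem, Holds]
  | cons x xs ih => simp [mem, Holds, ih]

@[simp] theorem holds_adjAll {y : ℕ} {xs : List ℕ} :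
    (adjAll y xs).Holds G d e ↔ ∀ v ∈ xs.map e, G.Adj (e y) v := by
  induction xs with
  | nil => simp [adjAll, Holds]
  | cons x xs ih => simp [adjAll, Holds, ih]

theorem map_update {xs : List ℕ} (hxs : ∀ x ∈ xs, x < d) (v : V) :
    xs.map (Function.update e d v) = xs.map e :=
  List.map_congr_left fun x hx => Function.update_of_ne (hxs x hx).ne _ _

theorem holds_nbrsEq {y : ℕ} {xs : List ℕ} (hy : y < d) (hxs : ∀ x ∈ xs, x < d) :
    (nbrsEq d y xs).Holds G d e ↔ ∀ t, G.Adj (e y) t ↔ t ∈ xs.map e := by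
  simp only [nbrsEq, nbrsSubset, Holds, holds_all, holds_imp, holds_mem, holds_adjAll,
    Function.update_self, Function.update_of_ne hy.ne, map_update hxs]
  exact ⟨fun h t => ⟨h.1 t, h.2 t⟩, fun h => ⟨fun t => (h t).1, fun t => (h t).2⟩⟩

theorem holds_pendant {w z : ℕ} (hw : w < d) (hz : z < d) :
    (pendant d w z).Holds G d e ↔ IsPendant G (e w) (e z) := by
  simp only [pendant, Holds, holds_all, holds_imp, Function.update_self,
    Function.update_of_ne hw.ne, Function.update_of_ne hz.ne, IsPendant]

theorem holds_core {w : ℕ} {xs : List ℕ} (hw : w < d) (hxs : ∀ x ∈ xs, x < d) :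
    (core d xs w).Holds G d e ↔ e w ∈ pendantCore G {v | v ∈ xs.map e} := by
  simp only [core, Holds, holds_mem, holds_pendant (Nat.lt_succ_of_lt hw) (Nat.lt_succ_self d),
    Function.update_self, Function.update_of_ne hw.ne, map_update hxs]
  rfl

theorem holds_tight {xs : List ℕ} (hxs : ∀ x ∈ xs, x < d) :
    (tight d xs).Holds G d e ↔ IsTight G {v | v ∈ xs.map e} := by
  have h1 : ∀ x ∈ xs, x < d + 1 := fun x hx => (hxs x hx).trans_le (by omega)
  have h2 : ∀ x ∈ xs, x < d + 2 := fun x hx => (hxs x hx).trans_le (by omega)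
  have h3 : ∀ x ∈ xs, x < d + 3 := fun x hx => (hxs x hx).trans_le (by omega)
  simp only [tight, holds_all, holds_imp, holds_or, holds_mem, Holds,
    holds_core (show d < d + 1 by omega) h1, holds_core (show d + 1 < d + 3 by omega) h3,
    holds_core (show d + 2 < d + 3 by omega) h3, map_update hxs, map_update h1, map_update h2,
    Function.update_self, Function.update_of_ne (show d ≠ d + 1 by omega),
    Function.update_of_ne (show d ≠ d + 2 by omega),
    Function.update_of_ne (show d + 1 ≠ d + 2 by omega)]
  rfl

theorem holds_nbrsCore {u : ℕ} {xs ys : List ℕ} (hu : u < d) (hxs : ∀ x ∈ xs, x < d)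
    (hys : ∀ x ∈ ys, x < d) :
    (nbrsCore d u xs ys).Holds G d e ↔
      ∀ t, G.Adj (e u) t → t ∈ pendantCore G {v | v ∈ xs.map e} ∨ t ∈ ys.map e := by
  simp only [nbrsCore, holds_all, holds_imp, holds_or, holds_mem, Holds,
    holds_core (Nat.lt_succ_self d) fun x hx => Nat.lt_succ_of_lt (hxs x hx), map_update hxs,
    map_update hys, Function.update_self, Function.update_of_ne hu.ne]

theorem setOf_mem_singleton (a : V) : {v | v ∈ [a]} = ({a} : Set V) := by
  ext; simp

theorem holds_oneVertex : oneVertex.Holds G 0 e ↔ OneVertexObstruction G := by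
  have h1 : ∀ x ∈ [0], x < 1 := by simp
  have h2 : ∀ x ∈ [0], x < 2 := by simp
  simp only [oneVertex, Holds, holds_core (show 1 < 2 by omega) h2, holds_tight h1, List.map,
    Function.update_apply, zero_add]
  simp only [reduceIte, one_ne_zero, zero_ne_one, setOf_mem_singleton]
  rfl

theorem holds_roof : roof.Holds G 0 e ↔ ∃ u v y, IsRoof G u v y := by
  simp only [roof, Holds, zero_add, Nat.reduceAdd]
  refine exists_congr fun u => exists_congr fun v => exists_congr fun y => ?_
  rw [holds_nbrsEq (by simp) (by simp), holds_tight (by simp),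
    holds_nbrsCore (by simp) (by simp) (by simp), holds_nbrsCore (by simp) (by simp) (by simp)]
  have e0 : Function.update (Function.update (Function.update e 0 u) 1 v) 2 y 0 = u := by
    simp
  have e1 : Function.update (Function.update (Function.update e 0 u) 1 v) 2 y 1 = v := by
    simp
  have e2 : Function.update (Function.update (Function.update e 0 u) 1 v) 2 y 2 = y := by simp
  simp only [List.map, e0, e1, e2, List.mem_cons, List.not_mem_nil, or_false]
  exact ⟨fun ⟨h1, h2, h3, h4, h5⟩ => ⟨h1, h2, h3, h4, h5⟩,
    fun ⟨h1, h2, h3, h4, h5⟩ => ⟨h1, h2, h3, h4, h5⟩⟩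

theorem holds_horned : horned.Holds G 0 e ↔ ∃ x a b y y', IsHorned G x a b y y' := by
  simp only [horned, Holds, zero_add, Nat.reduceAdd]
  refine exists_congr fun x => exists_congr fun a => exists_congr fun b => exists_congr fun y =>
    exists_congr fun y' => ?_
  obtain ⟨e', he'⟩ : ∃ e', e' = Function.update (Function.update (Function.update
    (Function.update (Function.update e 0 x) 1 a) 2 b) 3 y) 4 y' := ⟨_, rfl⟩
  have e0 : e' 0 = x := by simp [he']
  have e1 : e' 1 = a := by simp [he']
  have e2 : e' 2 = b := by simp [he']
  have e3 : e' 3 = y := by simp [he']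
  have e4 : e' 4 = y' := by simp [he']
  have hlt : ∀ t ∈ [1, 2], t < 5 := by simp
  rw [← he', holds_nbrsEq (by simp) (by simp), holds_nbrsEq (by simp) (by simp),
    holds_nbrsEq (by simp) (by simp), holds_tight (by simp),
    holds_nbrsCore (by simp) (by simp) (by simp), holds_nbrsCore (by simp) (by simp) (by simp)]
  simp only [holds_core (show 5 < 6 by omega) (fun t ht => (hlt t ht).trans (by omega)),
    map_update hlt, Function.update_self]
  simp only [List.map, e0, e1, e2, e3, e4, List.mem_cons, List.not_mem_nil, or_false]
  exact ⟨fun ⟨h1, h2, h3, h4, h5, h6, h7, h8, h9, h10⟩ => ⟨h1, h2, h3, h4, h5, h6, h7, h8, h9, h10⟩,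
    fun ⟨h1, h2, h3, h4, h5, h6, h7, h8, h9, h10⟩ => ⟨h1, h2, h3, h4, h5, h6, h7, h8, h9, h10⟩⟩

theorem holds_obstructed : obstructed.Holds G 0 e ↔ IsObstructed G := by
  rw [obstructed, holds_or, holds_or, holds_oneVertex, holds_roof, holds_horned, IsObstructed]

theorem wellScoped_obstructed : obstructed.WellScoped 0 := by
  simp [obstructed, oneVertex, roof, horned, nbrsCore, tight, core, pendant, nbrsEq, nbrsSubset,
    adjAll, mem, all, imp, or, WellScoped]

end Semantics

end Formula

/-- Whether a chordal graph of diameter at most three has a HIST can be decided in polynomial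
time. -/
theorem mainTheorem2 :
    RAM.DecidableInPolyTime
      (fun {n : ℕ} (G : SimpleGraph (Fin n)) => G.Connected ∧ IsChordal G ∧ G.ediam ≤ 3)
      (fun {n : ℕ} (G : SimpleGraph (Fin n)) => HasHIST G) := by
  refine RAM.decidableInPolyTime_of_sentence (.not .obstructed) Formula.wellScoped_obstructed ?_ ?_
  · rintro n G ⟨hconn, -⟩
    obtain ⟨v⟩ := hconn.nonempty
    exact v.pos
  · rintro n G ⟨hconn, hG, hd⟩ e
    have := hconn.nonempty
    rw [hG.hasHIST_iff hd]
    exact not_congr Formula.holds_obstructed
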